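/- Let $F$ be a field of characteristic different from $2$. Let $GW(F)$ be the Grothendieck--Witt ring of $F$, i.e. the Grothendieck group of isometry classes of finite-dimensional nondegenerate symmetric bilinear forms over $F$ under orthogonal sum, with product induced by the tensor product; let $\langle a\rangle\in GW(F)$ ($a\in F^\times$) be the class of the form $(x,y)\mapsto axy$; let $W(F)=GW(F)/(\langle 1\rangle+\langle -1\rangle)$ be the Witt ring; and let $\operatorname{rank}\colon W(F)\to\mathbb Z/2$ be the homomorphism induced by the dimension. Let $K^{MW}_*(F)$ be the Milnor--Witt K-ring: the $\mathbb Z$-graded unital associative ring generated by symbols $[u]$ ($u\in F^\times$) of degree $1$ and an element $\eta$ of degree $-1$, subject to the relations $[a][b]=0$ for $a+b=1$, $[ab]=[a]+[b]+\eta[a][b]$, $[u]\eta=\eta[u]$ and $\eta(\eta[-1]+2)=0$. Put $K^{MW}_{\le 0}(F)=\bigoplus_{n\le 0}K^{MW}_n(F)$. There is a ring isomorphism $\iota\colon GW(F)\to K^{MW}_0(F)$ with $\iota(\langle a\rangle)=1+\eta[a]$ for all $a\in F^\times$, and for every $n\ge 1$ an isomorphism of abelian groups $W(F)\to K^{MW}_{-n}(F)$,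 written $\phi\mapsto\phi\eta^n$, that sends the class of $x\in GW(F)$ to $\iota(x)\eta^n$. With respect to these identifications: 1. Every torsion element $x\in K^{MW}_{\le 0}(F)$ is $2$-primary torsion, i.e. $2^m x=0$ for some $m\ge 0$. 2. An element of $K^{MW}_0(F)\cong GW(F)$ is nilpotent if and only if it is torsion. 3. For every $n\ge 1$, the nilpotent elements of $K^{MW}_{-n}(F)$ are precisely the elements $\phi\eta^n$ with $\phi\in W(F)$ a torsion element with $\operatorname{rank}\phi=0\in\mathbb Z/2$ (i.e. of even rank). (Torsion always means $\mathbb Z$-torsion.) -/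

import Mathlib

universe u

open scoped TensorProduct

noncomputable section

/-! ### Symmetric bilinear spaces and their isometry classes -/

/-- A finite-dimensional vector space with a nondegenerate symmetric bilinear form. Over a field of
characteristic not two this is the same thing as a nondegenerate quadratic space. -/
structure BilinSpace (F : Type u) [Field F] : Type (u + 1) where
  V : Type u
  [addCommGroup : AddCommGroup V]
  [module : Module F V]
  [finite : FiniteDimensional F V]
  form : LinearMap.BilinForm F V
  symm : ∀ x y, form x y = form y x
  nondeg : form.Nondegenerate

attribute [instance] BilinSpace.addCommGroup BilinSpace.module BilinSpace.finite

namespace BilinSpace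

variable {F : Type u} [Field F]

/-- Isometry of bilinear spaces. -/
def Isometric (A B : BilinSpace F) : Prop :=
  ∃ e : A.V ≃ₗ[F] B.V, ∀ x y, B.form (e x) (e y) = A.form x y

instance isometrySetoid (F : Type u) [Field F] : Setoid (BilinSpace F) where
  r := Isometric
  iseqv :=
    { refl := fun A => ⟨LinearEquiv.refl F A.V, fun _ _ => rfl⟩
      symm := by
        rintro A B ⟨e, he⟩
        exact ⟨e.symm, fun x y => by simpa using (he (e.symm x) (e.symm y)).symm⟩
      trans := by
        rintro A B C ⟨e, he⟩ ⟨f, hf⟩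
        exact ⟨e.trans f, fun x y => by simp [hf, he]⟩ }

lemma nondegenerate_of_left {V : Type u} [AddCommGroup V] [Module F V]
    {B : LinearMap.BilinForm F V} (hs : ∀ x y, B x y = B y x)
    (h : ∀ x, (∀ y, B x y = 0) → x = 0) : B.Nondegenerate :=
  ⟨h, fun y hy => h y fun x => by rw [hs]; exact hy x⟩

/-- The zero space. -/
def zero (F : Type u) [Field F] : BilinSpace F where
  V := PUnit
  form := 0
  symm := fun _ _ => rfl
  nondeg := nondegenerate_of_left (fun _ _ => rfl) fun _ _ => rfl

/-- The one-dimensional form `⟨a⟩`, i.e. `(x, y) ↦ a x y`. -/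
def diag (a : Fˣ) : BilinSpace F where
  V := F
  form := (a : F) • LinearMap.mul F F
  symm := fun x y => by simp [mul_comm]
  nondeg := nondegenerate_of_left (fun x y => by simp [mul_comm]) fun x hx => by
    simpa using hx 1

/-- The orthogonal sum. -/
def sum (A B : BilinSpace F) : BilinSpace F where
  V := A.V × B.V
  form := A.form.compl₁₂ (LinearMap.fst F A.V B.V) (LinearMap.fst F A.V B.V) +
    B.form.compl₁₂ (LinearMap.snd F A.V B.V) (LinearMap.snd F A.V B.V)
  symm := fun x y => by simp [A.symm x.1, B.symm x.2]
  nondeg := nondegenerate_of_left (fun x y => by simp [A.symm x.1, B.symm x.2]) fun x hx => by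
    refine Prod.ext (A.nondeg.1 _ fun y => ?_) (B.nondeg.1 _ fun y => ?_)
    · simpa using hx (y, 0)
    · simpa using hx (0, y)

lemma sum_form (A B : BilinSpace F) (x y : A.V × B.V) :
    (A.sum B).form x y = A.form x.1 y.1 + B.form x.2 y.2 := rfl

lemma tmul_symm (A B : BilinSpace F) (x y : A.V ⊗[F] B.V) :
    (A.form.tmul B.form) x y = (A.form.tmul B.form) y x := by
  have h : (A.form.tmul B.form).IsSymm :=
    LinearMap.IsSymm.tmul ⟨fun x y => A.symm x y⟩ ⟨fun x y => B.symm x y⟩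
  exact h.eq x y

lemma tmul_nondeg (A B : BilinSpace F) :
    LinearMap.BilinForm.Nondegenerate (A.form.tmul B.form) := by
  refine nondegenerate_of_left (tmul_symm A B) ?_
  let e : A.V ⊗[F] B.V ≃ₗ[F] Module.Dual F (A.V ⊗[F] B.V) :=
    (TensorProduct.congr (A.form.toDual A.nondeg) (B.form.toDual B.nondeg)).trans
      (TensorProduct.dualDistribEquiv F A.V B.V)
  have he : (e : A.V ⊗[F] B.V →ₗ[F] Module.Dual F (A.V ⊗[F] B.V)) = A.form.tmul B.form := by
    refine TensorProduct.ext' fun a b => TensorProduct.ext' fun c d => ?_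
    simp [e, TensorProduct.dualDistribEquiv, TensorProduct.dualDistribEquivOfBasis,
      LinearMap.BilinForm.toDual_def, mul_comm]
  intro x hx
  have h0 : e x = 0 := by
    have h1 : e x = (A.form.tmul B.form) x := LinearMap.congr_fun he x
    rw [h1]
    exact LinearMap.ext hx
  simpa using h0

/-- The tensor product of bilinear spaces. -/
def tensor (A B : BilinSpace F) : BilinSpace F where
  V := A.V ⊗[F] B.V
  form := A.form.tmul B.form
  symm := tmul_symm A B
  nondeg := tmul_nondeg A B

lemma tensor_form (A B : BilinSpace F) (a c : A.V) (b d : B.V) :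
    (A.tensor B).form (a ⊗ₜ[F] b) (c ⊗ₜ[F] d) = A.form a c * B.form b d :=
  (LinearMap.BilinForm.tensorDistrib_tmul F F A.form B.form a b c d).trans (mul_comm _ _)

/-- Two bilinear forms which agree on a linear equivalence of a tensor product, on pure tensors,
are isometric. -/
lemma isometric_of_tmul {A B C : BilinSpace F} (e : (A.tensor B).V ≃ₗ[F] C.V)
    (h : ∀ (a c : A.V) (b d : B.V),
      C.form (e (a ⊗ₜ[F] b)) (e (c ⊗ₜ[F] d)) = A.form a c * B.form b d) :
    Isometric (A.tensor B) C := by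
  refine ⟨e, fun x y => ?_⟩
  have h2 : C.form.compl₁₂ e.toLinearMap e.toLinearMap = (A.tensor B).form := by
    refine TensorProduct.ext' fun a b => TensorProduct.ext' fun c d => ?_
    exact (h a c b d).trans (tensor_form A B a c b d).symm
  exact LinearMap.congr_fun₂ h2 x y

lemma sum_congr {A A' B B' : BilinSpace F} (h : Isometric A A') (h' : Isometric B B') :
    Isometric (A.sum B) (A'.sum B') := by
  obtain ⟨e, he⟩ := h
  obtain ⟨f, hf⟩ := h'
  refine ⟨e.prodCongr f, fun x y => ?_⟩
  exact congrArg₂ (· + ·) (he x.1 y.1) (hf x.2 y.2)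

lemma tensor_congr {A A' B B' : BilinSpace F} (h : Isometric A A') (h' : Isometric B B') :
    Isometric (A.tensor B) (A'.tensor B') := by
  obtain ⟨e, he⟩ := h
  obtain ⟨f, hf⟩ := h'
  refine isometric_of_tmul (C := A'.tensor B') (TensorProduct.congr e f) fun a c b d => ?_
  exact (tensor_form A' B' (e a) (e c) (f b) (f d)).trans (congrArg₂ (· * ·) (he a c) (hf b d))

lemma zero_sum (A : BilinSpace F) : Isometric ((zero F).sum A) A :=
  ⟨LinearEquiv.uniqueProd (R := F) (M := A.V) (M₂ := (PUnit : Type u)), fun _ _ => (zero_add _).symm⟩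

lemma sum_comm (A B : BilinSpace F) : Isometric (A.sum B) (B.sum A) :=
  ⟨LinearEquiv.prodComm F A.V B.V, fun _ _ => add_comm _ _⟩

lemma sum_assoc (A B C : BilinSpace F) :
    Isometric ((A.sum B).sum C) (A.sum (B.sum C)) :=
  ⟨LinearEquiv.prodAssoc F A.V B.V C.V, fun _ _ => (add_assoc _ _ _).symm⟩

lemma tensor_comm (A B : BilinSpace F) : Isometric (A.tensor B) (B.tensor A) :=
  isometric_of_tmul (C := B.tensor A) (TensorProduct.comm F A.V B.V) fun a c b d =>
    (tensor_form B A b d a c).trans (mul_comm _ _)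

lemma one_tensor (A : BilinSpace F) : Isometric ((diag 1).tensor A) A :=
  isometric_of_tmul (A := diag 1) (TensorProduct.lid F A.V) fun (a c : F) b d => by
    have h1 : (diag (1 : Fˣ)).form a c = a * c := one_mul (a * c)
    have h2 : A.form (a • b) (c • d) = a * c * A.form b d := by simp [mul_assoc, mul_left_comm]
    exact h2.trans (congrArg (· * A.form b d) h1.symm)

lemma zero_tensor (A : BilinSpace F) : Isometric ((zero F).tensor A) (zero F) := by
  have : Subsingleton ((zero F).tensor A).V :=
    inferInstanceAs (Subsingleton ((PUnit : Type u) ⊗[F] A.V))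
  have : Subsingleton (zero F).V := inferInstanceAs (Subsingleton PUnit)
  refine ⟨⟨0, 0, fun _ => Subsingleton.elim _ _, fun _ => Subsingleton.elim _ _⟩, fun x y => ?_⟩
  rw [Subsingleton.elim x 0]
  simp

lemma tensor_assoc (A B C : BilinSpace F) :
    Isometric ((A.tensor B).tensor C) (A.tensor (B.tensor C)) := by
  refine ⟨TensorProduct.assoc F A.V B.V C.V, fun x y => ?_⟩
  have h2 : (A.tensor (B.tensor C)).form.compl₁₂
      (TensorProduct.assoc F A.V B.V C.V).toLinearMap
      (TensorProduct.assoc F A.V B.V C.V).toLinearMap = ((A.tensor B).tensor C).form := by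
    refine TensorProduct.ext_threefold fun a b c => TensorProduct.ext_threefold fun a' b' c' => ?_
    have h1 := tensor_form (A.tensor B) C (a ⊗ₜ b) (a' ⊗ₜ b') c c'
    rw [tensor_form] at h1
    have h3 := tensor_form A (B.tensor C) a a' (b ⊗ₜ c) (b' ⊗ₜ c')
    rw [tensor_form] at h3
    exact h3.trans ((mul_assoc _ _ _).symm.trans h1.symm)
  exact LinearMap.congr_fun₂ h2 x y

lemma sum_tensor (A B C : BilinSpace F) :
    Isometric ((A.sum B).tensor C) ((A.tensor C).sum (B.tensor C)) :=
  isometric_of_tmul (A := A.sum B) (C := (A.tensor C).sum (B.tensor C))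
    (TensorProduct.prodLeft F F A.V B.V C.V) fun a c b d => by
      have h := sum_form (A.tensor C) (B.tensor C) (a.1 ⊗ₜ b, a.2 ⊗ₜ b) (c.1 ⊗ₜ d, c.2 ⊗ₜ d)
      rw [tensor_form, tensor_form, ← add_mul] at h
      exact h

end BilinSpace

/-- Isometry classes of nondegenerate symmetric bilinear spaces. -/
def BilinClass (F : Type u) [Field F] : Type (u + 1) := Quotient (BilinSpace.isometrySetoid F)

namespace BilinClass

variable {F : Type u} [Field F]

/-- The class of a space. -/
def mk (A : BilinSpace F) : BilinClass F := Quotient.mk _ A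

lemma sound {A B : BilinSpace F} (h : A.Isometric B) : mk A = mk B := Quotient.sound h

instance : Add (BilinClass F) :=
  ⟨Quotient.map₂ BilinSpace.sum fun _ _ h _ _ h' => BilinSpace.sum_congr h h'⟩

instance : Mul (BilinClass F) :=
  ⟨Quotient.map₂ BilinSpace.tensor fun _ _ h _ _ h' => BilinSpace.tensor_congr h h'⟩

instance : Zero (BilinClass F) := ⟨mk (BilinSpace.zero F)⟩

instance : One (BilinClass F) := ⟨mk (BilinSpace.diag 1)⟩

protected lemma add_comm' (a b : BilinClass F) : a + b = b + a :=
  Quotient.inductionOn₂ a b fun A B => sound (A.sum_comm B)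

protected lemma mul_comm' (a b : BilinClass F) : a * b = b * a :=
  Quotient.inductionOn₂ a b fun A B => sound (A.tensor_comm B)

protected lemma zero_add' (a : BilinClass F) : 0 + a = a :=
  Quotient.inductionOn a fun A => sound A.zero_sum

protected lemma zero_mul' (a : BilinClass F) : 0 * a = 0 :=
  Quotient.inductionOn a fun A => sound A.zero_tensor

protected lemma one_mul' (a : BilinClass F) : 1 * a = a :=
  Quotient.inductionOn a fun A => sound A.one_tensor

protected lemma add_mul' (a b c : BilinClass F) : (a + b) * c = a * c + b * c :=
  Quotient.inductionOn₃ a b c fun A B C => sound (A.sum_tensor B C)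

/-- Isometry classes form a commutative semiring under orthogonal sum and tensor product. -/
instance : CommSemiring (BilinClass F) where
  add_assoc a b c := Quotient.inductionOn₃ a b c fun A B C => sound (A.sum_assoc B C)
  zero_add := BilinClass.zero_add'
  add_zero a := by rw [BilinClass.add_comm', BilinClass.zero_add']
  add_comm := BilinClass.add_comm'
  mul_assoc a b c := Quotient.inductionOn₃ a b c fun A B C => sound (A.tensor_assoc B C)
  mul_comm := BilinClass.mul_comm'
  one_mul := BilinClass.one_mul'
  mul_one a := by rw [BilinClass.mul_comm', BilinClass.one_mul']
  zero_mul := BilinClass.zero_mul'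
  mul_zero a := by rw [BilinClass.mul_comm', BilinClass.zero_mul']
  right_distrib := BilinClass.add_mul'
  left_distrib a b c := by
    rw [BilinClass.mul_comm', BilinClass.add_mul', BilinClass.mul_comm' b,
      BilinClass.mul_comm' c]
  nsmul := nsmulRec

/-- The rank (dimension) as a semiring homomorphism. -/
def rank (F : Type u) [Field F] : BilinClass F →+* ℕ where
  toFun := Quotient.lift (fun A : BilinSpace F => Module.finrank F A.V)
    fun _ _ ⟨e, _⟩ => e.finrank_eq
  map_one' := Module.finrank_self F
  map_mul' a b := Quotient.inductionOn₂ a b fun A B =>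
    Module.finrank_tensorProduct (R := F) (S := F) (M := A.V) (M' := B.V)
  map_zero' := Module.finrank_zero_of_subsingleton (R := F) (M := (PUnit : Type u))
  map_add' a b := Quotient.inductionOn₂ a b fun A B =>
    Module.finrank_prod (R := F) (M := A.V) (M' := B.V)

end BilinClass

/-! ### The Grothendieck-Witt ring and the Witt ring -/

/-- The Grothendieck-Witt ring `GW(F)`: the Grothendieck group of the additive monoid of isometry
classes, with the product induced by the tensor product. -/
def GW (F : Type u) [Field F] : Type (u + 1) := Algebra.GrothendieckAddGroup (BilinClass F)

namespace GW

variable {F : Type u} [Field F]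

instance : AddCommGroup (GW F) :=
  inferInstanceAs (AddCommGroup (Algebra.GrothendieckAddGroup (BilinClass F)))

/-- The class in `GW(F)` of an isometry class. -/
def ofClass : BilinClass F →+ GW F := Algebra.GrothendieckAddGroup.of

/-- Universal property of the underlying additive group. -/
def liftAdd {G : Type*} [AddCommGroup G] : (BilinClass F →+ G) ≃ (GW F →+ G) :=
  Algebra.GrothendieckAddGroup.lift

@[simp]
lemma liftAdd_ofClass {G : Type*} [AddCommGroup G] (f : BilinClass F →+ G)
    (a : BilinClass F) : liftAdd f (ofClass a) = f a :=
  DFunLike.congr_fun (liftAdd.symm_apply_apply f) a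

lemma addHom_ext {G : Type*} [AddCommGroup G] {f g : GW F →+ G}
    (h : ∀ a, f (ofClass a) = g (ofClass a)) : f = g :=
  liftAdd.symm.injective (AddMonoidHom.ext h)

/-- Multiplication as a biadditive map. -/
def mulHom : GW F →+ GW F →+ GW F :=
  liftAdd
    { toFun := fun a => liftAdd (ofClass.comp (AddMonoidHom.mulLeft a))
      map_zero' := addHom_ext fun b => by simp
      map_add' := fun a a' => addHom_ext fun b => by simp [add_mul] }

instance : Mul (GW F) := ⟨fun x y => mulHom x y⟩

instance : One (GW F) := ⟨ofClass 1⟩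

lemma mul_def (x y : GW F) : x * y = mulHom x y := rfl

lemma ofClass_mul (a b : BilinClass F) : ofClass (a * b) = ofClass a * ofClass b := by
  simp [mul_def, mulHom]

/-- Every element of `GW(F)` is a difference of classes of spaces. -/
lemma exists_eq_sub (x : GW F) : ∃ a b, x = ofClass a - ofClass b := by
  have key : ∀ x : Algebra.GrothendieckAddGroup (BilinClass F),
      ∃ a b, x = Algebra.GrothendieckAddGroup.of a - Algebra.GrothendieckAddGroup.of b := by
    intro x
    obtain ⟨⟨a, b⟩, h⟩ := (AddLocalization.addMonoidOf ⊤).surj x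
    exact ⟨a, b, eq_sub_of_add_eq h⟩
  exact key x

lemma ind {p : GW F → Prop} (of : ∀ a, p (ofClass a))
    (sub : ∀ x y, p x → p y → p (x - y)) (x : GW F) : p x := by
  obtain ⟨a, b, rfl⟩ := exists_eq_sub x
  exact sub _ _ (of a) (of b)

protected lemma add_mul' (x y z : GW F) : (x + y) * z = x * z + y * z := by simp [mul_def]

protected lemma mul_add' (x y z : GW F) : x * (y + z) = x * y + x * z := by simp [mul_def]

protected lemma sub_mul' (x y z : GW F) : (x - y) * z = x * z - y * z := by simp [mul_def]

protected lemma mul_sub' (x y z : GW F) : x * (y - z) = x * y - x * z := by simp [mul_def]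

protected lemma mul_comm' (x y : GW F) : x * y = y * x := by
  induction x using ind with
  | sub u v h h' => rw [GW.mul_sub', GW.sub_mul', h, h']
  | of a =>
    induction y using ind with
    | sub u v h h' => rw [GW.mul_sub', GW.sub_mul', h, h']
    | of b => rw [← ofClass_mul, ← ofClass_mul, mul_comm]

protected lemma mul_assoc' (x y z : GW F) : x * y * z = x * (y * z) := by
  induction x using ind with
  | sub u v h h' => rw [GW.sub_mul', GW.sub_mul', GW.sub_mul', h, h']
  | of a =>
    induction y using ind with
    | sub u v h h' => rw [GW.mul_sub', GW.sub_mul', GW.sub_mul', GW.mul_sub', h, h']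
    | of b =>
      induction z using ind with
      | sub u v h h' => rw [GW.mul_sub', GW.mul_sub', GW.mul_sub', h, h']
      | of c => rw [← ofClass_mul, ← ofClass_mul, ← ofClass_mul, ← ofClass_mul, mul_assoc]

protected lemma one_mul' (x : GW F) : 1 * x = x := by
  induction x using ind with
  | sub u v h h' => rw [GW.mul_sub', h, h']
  | of a => exact (ofClass_mul 1 a).symm.trans (by rw [one_mul])

instance : CommRing (GW F) where
  __ := (inferInstance : AddCommGroup (GW F))
  left_distrib := GW.mul_add'
  right_distrib := GW.add_mul'
  zero_mul x := by simp [mul_def]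
  mul_zero x := by simp [mul_def]
  mul_assoc := GW.mul_assoc'
  one_mul := GW.one_mul'
  mul_one x := by rw [GW.mul_comm', GW.one_mul']
  mul_comm := GW.mul_comm'

/-- The class of the one-dimensional form `⟨a⟩` in `GW(F)`. -/
def diag (a : Fˣ) : GW F := ofClass (BilinClass.mk (BilinSpace.diag a))

/-- The class of the hyperbolic plane `⟨1⟩ + ⟨-1⟩`. -/
def hyp (F : Type u) [Field F] : GW F := diag 1 + diag (-1)

/-- The additive map underlying `rank`. -/
def rankAdd (F : Type u) [Field F] : GW F →+ ℤ :=
  liftAdd ((Nat.castAddMonoidHom ℤ).comp (BilinClass.rank F).toAddMonoidHom)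

lemma rankAdd_ofClass (a : BilinClass F) :
    rankAdd F (ofClass a) = (BilinClass.rank F a : ℤ) := by
  simp [rankAdd]

/-- The rank homomorphism `GW(F) → ℤ`. -/
def rank (F : Type u) [Field F] : GW F →+* ℤ where
  __ := rankAdd F
  map_one' := (rankAdd_ofClass 1).trans (by simp)
  map_mul' x y := by
    change rankAdd F (x * y) = rankAdd F x * rankAdd F y
    induction x using ind with
    | sub u v h h' => rw [sub_mul, map_sub, map_sub, h, h', sub_mul]
    | of a =>
      induction y using ind with
      | sub u v h h' => rw [mul_sub, map_sub, map_sub, h, h', mul_sub]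
      | of b =>
        rw [← ofClass_mul, rankAdd_ofClass, rankAdd_ofClass, rankAdd_ofClass, map_mul,
          Nat.cast_mul]

lemma rank_diag (a : Fˣ) : rank F (diag a) = 1 := by
  have h : BilinClass.rank F (BilinClass.mk (BilinSpace.diag a)) = 1 :=
    Module.finrank_self F
  exact (rankAdd_ofClass _).trans (by rw [h, Nat.cast_one])

lemma rank_hyp : rank F (hyp F) = 2 := by
  rw [hyp, map_add, rank_diag, rank_diag]
  norm_num

end GW

/-- The Witt ring `W(F)`: the quotient of `GW(F)` by the ideal generated by the hyperbolic plane. -/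
abbrev Witt (F : Type u) [Field F] : Type (u + 1) := GW F ⧸ Ideal.span {GW.hyp F}

namespace Witt

/-- The canonical projection `GW(F) → W(F)`. -/
abbrev proj (F : Type u) [Field F] : GW F →+* Witt F := Ideal.Quotient.mk _

/-- The rank homomorphism `W(F) → ℤ/2`. -/
def rank (F : Type u) [Field F] : Witt F →+* ZMod 2 :=
  Ideal.Quotient.lift _ ((Int.castRingHom (ZMod 2)).comp (GW.rank F)) fun x hx => by
    obtain ⟨y, rfl⟩ := Ideal.mem_span_singleton'.1 hx
    rw [RingHom.comp_apply, map_mul, GW.rank_hyp, map_mul]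
    have h : Int.castRingHom (ZMod 2) 2 = 0 := rfl
    rw [h, mul_zero]

end Witt

/-! ### The Milnor-Witt K-ring -/

/-- Generators of the Milnor-Witt K-ring: `η` and the symbols `[u]`, for units `u`. -/
inductive KMWGen (F : Type u) [Field F] : Type u
  | eta : KMWGen F
  | symbol (a : Fˣ) : KMWGen F

namespace KMWGen

variable {F : Type u} [Field F]

/-- `η` has degree `-1`, symbols have degree `1`. -/
def degree : KMWGen F → ℤ
  | eta => -1
  | symbol _ => 1

/-- The generator `η` in the free associative ring. -/
abbrev freeEta (F : Type u) [Field F] : FreeAlgebra ℤ (KMWGen F) := FreeAlgebra.ι ℤ eta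

/-- The generator `[a]` in the free associative ring. -/
abbrev freeSymbol (a : Fˣ) : FreeAlgebra ℤ (KMWGen F) := FreeAlgebra.ι ℤ (symbol a)

end KMWGen

open KMWGen in
/-- The defining relations of the Milnor-Witt K-ring (Hopkins-Morel). -/
inductive KMWRel (F : Type u) [Field F] :
    FreeAlgebra ℤ (KMWGen F) → FreeAlgebra ℤ (KMWGen F) → Prop
  | steinberg (a b : Fˣ) (h : (a : F) + b = 1) : KMWRel F (freeSymbol a * freeSymbol b) 0
  | symbol_mul (a b : Fˣ) : KMWRel F (freeSymbol (a * b))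
      (freeSymbol a + freeSymbol b + freeEta F * freeSymbol a * freeSymbol b)
  | eta_comm (a : Fˣ) : KMWRel F (freeSymbol a * freeEta F) (freeEta F * freeSymbol a)
  | eta_hyp : KMWRel F (freeEta F * (freeEta F * freeSymbol (-1) + 2)) 0

/-- The Milnor-Witt K-ring `K^MW_*(F)`: the free associative unital ring on `η` and the symbols
`[u]`, modulo the relations `KMWRel`. -/
abbrev KMW (F : Type u) [Field F] : Type u := RingQuot (KMWRel F)

namespace KMW

variable {F : Type u} [Field F]

/-- The image of a generator. -/
def gen (g : KMWGen F) : KMW F := RingQuot.mkAlgHom ℤ (KMWRel F) (FreeAlgebra.ι ℤ g)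

/-- The element `η`, of degree `-1`. -/
def eta (F : Type u) [Field F] : KMW F := gen KMWGen.eta

/-- The symbol `[a]`, of degree `1`. -/
def symbol (a : Fˣ) : KMW F := gen (KMWGen.symbol a)

/-- The homogeneous part `K^MW_n(F)`: the additive subgroup generated by the words of degree `n` in
the generators. -/
def homog (F : Type u) [Field F] (n : ℤ) : AddSubgroup (KMW F) :=
  AddSubgroup.closure
    {x | ∃ l : List (KMWGen F), (l.map KMWGen.degree).sum = n ∧ x = (l.map gen).prod}

/-- The non-positive part `K^MW_{≤ 0}(F)`, the sum of all `K^MW_n(F)` with `n ≤ 0`. -/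
def nonpos (F : Type u) [Field F] : AddSubgroup (KMW F) := ⨆ (n : ℤ) (_ : n ≤ 0), homog F n

end KMW

end

/-! In `GW(F)` the classes satisfy ⟨a⟩² = 1 and, for a + b = 1, (⟨a⟩ - 1)(⟨b⟩ - 1) = 0. By Witt's
chain equivalence (`IsDiagonal.sum_eq`), such relations present the ring (`GW.exists_ringHom`). This
presentation is used twice: to build ring homomorphisms `W(F)` → ℤ, and to build ι.

Torsion and nilpotents in `W(F)` are read off from prime ideals P. Modulo P every ⟨a⟩ is ±1. If 2 ∉
P, the signs define a signature s : `W(F)` → ℤ, and each y agrees with s(y) after multiplication by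
some t ∉ P (`Witt.exists_signature`). If every signature of x vanishes, the annihilator of x
therefore contains a power of 2. Since ℤ is torsion-free and reduced, this applies both to torsion
and to nilpotent x. If 2 ∈ P, then P contains all elements of even rank, so torsion of even rank
lies in every prime ideal. The results pass to `GW(F)` because an element there is determined by its
Witt class and its integral rank (`GW.eq_zero_of_proj_of_rank`).

In Milnor–Witt K-theory, η is central and the elements 1 + η[a] satisfy the relations of `GW(F)`,
which gives ι; every element of degree -n ≤ 0 has the form ι(y)ηⁿ. Injectivity comes from two
explicit quotients: [a] ↦ (⟨a⟩ - 1)η⁻¹ into `W(F)`[η, η⁻¹], which detects Witt classes degree by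
degree, and the map to ℤ killing η and all symbols, which detects the rank. Finally (φηⁿ)ᵏ = φᵏηⁿᵏ
reduces nilpotence in negative degrees to `W(F)`. -/

noncomputable section

/-! ### Diagonalizations of symmetric bilinear forms -/

/-- Compares sums before and after a rotation, which only changes two members of a family. -/
lemma Fintype.sum_eq_sum_of_pair {ι A : Type*} [Fintype ι] [AddCommGroup A] {p q : ι → A} {i j : ι}
    (hij : i ≠ j) (h : ∀ k, k ≠ i → k ≠ j → p k = q k) (h2 : p i + p j = q i + q j) :
    ∑ k, p k = ∑ k, q k := by
  classical
  rw [← sub_eq_zero, ← Finset.sum_sub_distrib,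
    Fintype.sum_eq_add i j hij fun k hk => sub_eq_zero.2 (h k hk.1 hk.2)]
  rw [← sub_eq_zero] at h2
  rw [← h2]
  abel

namespace LinearMap.BilinForm

variable {F V : Type*} [Field F] [AddCommGroup V] [Module F V]

open scoped Classical in
/-- The family `e` is orthogonal for `B`, with invertible diagonal values `a`. -/
def IsDiagonal (B : LinearMap.BilinForm F V) {ι : Type*} (e : ι → V) (a : ι → Fˣ) : Prop :=
  ∀ i j, B (e i) (e j) = if i = j then (a i : F) else 0

variable {B : LinearMap.BilinForm F V}

namespace IsDiagonal

variable {ι : Type*} {e : ι → V} {a : ι → Fˣ}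

lemma self (h : B.IsDiagonal e a) (i : ι) : B (e i) (e i) = a i := by simp [h i i]

lemma of_ne (h : B.IsDiagonal e a) {i j : ι} (hij : i ≠ j) : B (e i) (e j) = 0 := by
  simp [h i j, hij]

lemma mk' (h1 : ∀ i, B (e i) (e i) = a i) (h2 : ∀ i j, i ≠ j → B (e i) (e j) = 0) :
    B.IsDiagonal e a := by
  intro i j
  by_cases h : i = j
  · subst h; simp [h1]
  · simp [h, h2 i j h]

lemma comp (h : B.IsDiagonal e a) {κ : Type*} {s : κ → ι} (hs : Function.Injective s) :
    B.IsDiagonal (e ∘ s) (a ∘ s) :=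
  mk' (fun _ => h.self _) fun _ _ hij => h.of_ne (hs.ne hij)

lemma apply_sum [Fintype ι] (h : B.IsDiagonal e a) (c : ι → F) (j : ι) :
    B (∑ i, c i • e i) (e j) = c j * a j := by
  rw [map_sum, LinearMap.sum_apply, Fintype.sum_eq_single j fun i hi => by simp [h.of_ne hi]]
  simp [h.self]

lemma sum_sum [Fintype ι] (h : B.IsDiagonal e a) (c : ι → F) :
    B (∑ i, c i • e i) (∑ i, c i • e i) = ∑ i, a i * c i ^ 2 := by
  rw [map_sum]
  refine Finset.sum_congr rfl fun j _ => ?_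
  rw [map_smul, h.apply_sum, smul_eq_mul]
  ring

/-- Rotating two members of an orthogonal family inside the plane they span. -/
lemma rotate (h : B.IsDiagonal e a) [DecidableEq ι] {i j : ι} (hij : i ≠ j) {x y : F} {γ : Fˣ}
    (hγ : (γ : F) = a i * x ^ 2 + a j * y ^ 2) :
    B.IsDiagonal
      (fun k => if k = i then x • e i + y • e j else
        if k = j then ((a j : F) * y) • e i - ((a i : F) * x) • e j else e k)
      (fun k => if k = i then γ else if k = j then a i * a j * γ else a k) := by
  refine mk' (fun k => ?_) fun k l hkl => ?_
  · by_cases hk : k = i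
    · subst hk
      simp [h.self, h.of_ne hij, h.of_ne hij.symm, hγ]
      ring
    by_cases hk' : k = j
    · subst hk'
      simp [h.self, h.of_ne hij, h.of_ne hij.symm, hγ, hk]
      ring
    simp [hk, hk', h.self]
  · by_cases hk : k = i
    · subst hk
      have hl : l ≠ k := hkl.symm
      by_cases hl' : l = j
      · subst hl'
        simp [h.self, h.of_ne hij, h.of_ne hij.symm, hl]
        ring
      · simp [hl, hl', h.of_ne hkl, h.of_ne (Ne.symm hl')]
    by_cases hk' : k = j
    · subst hk'
      have hl : l ≠ k := hkl.symm
      by_cases hl' : l = i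
      · subst hl'
        simp [h.self, h.of_ne hij, h.of_ne hij.symm, hk]
        ring
      · simp [hk, hl, hl', h.of_ne hkl, h.of_ne (Ne.symm hl')]
    by_cases hl : l = i
    · subst hl
      simp [hk, hk', h.of_ne hk, h.of_ne hk']
    by_cases hl' : l = j
    · subst hl'
      simp [hk, hk', hl, h.of_ne hk, h.of_ne hk']
    simp [hk, hk', hl, hl', h.of_ne hkl]

/-- The rotation matrix has determinant -γ, which is a unit, so the old vectors can be recovered
from the new ones. -/
lemma span_le_span_rotate [DecidableEq ι] {i j : ι} (hij : i ≠ j) {x y : F} {γ : Fˣ}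
    (hγ : (γ : F) = a i * x ^ 2 + a j * y ^ 2) :
    Submodule.span F (Set.range e) ≤ Submodule.span F (Set.range
      (fun k => if k = i then x • e i + y • e j else
        if k = j then ((a j : F) * y) • e i - ((a i : F) * x) • e j else e k)) := by
  set e' : ι → V := fun k => if k = i then x • e i + y • e j else
        if k = j then ((a j : F) * y) • e i - ((a i : F) * x) • e j else e k with he'
  have hm : ∀ k, e' k ∈ Submodule.span F (Set.range e') := fun k => Submodule.subset_span ⟨k, rfl⟩
  have hi : e' i = x • e i + y • e j := by simp [he']
  have hj : e' j = ((a j : F) * y) • e i - ((a i : F) * x) • e j := by simp [he', hij.symm]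
  rw [Submodule.span_le]
  rintro _ ⟨k, rfl⟩
  by_cases hk : k = i
  · subst hk
    have : e k = (γ⁻¹ : F) • ((a k * x) • e' k + y • e' j) := by
      rw [hi, hj, eq_inv_smul_iff₀ γ.ne_zero, hγ]
      module
    rw [this]
    exact Submodule.smul_mem _ _ (add_mem (Submodule.smul_mem _ _ (hm _))
      (Submodule.smul_mem _ _ (hm _)))
  by_cases hk' : k = j
  · subst hk'
    have : e k = (γ⁻¹ : F) • ((a k * y) • e' i - x • e' k) := by
      rw [hi, hj, eq_inv_smul_iff₀ γ.ne_zero, hγ]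
      module
    rw [this]
    exact Submodule.smul_mem _ _ (sub_mem (Submodule.smul_mem _ _ (hm _))
      (Submodule.smul_mem _ _ (hm _)))
  · have : e k = e' k := by simp [he', hk, hk']
    rw [this]
    exact hm k

end IsDiagonal

/-- If at least two terms are nonzero and the total is nonzero, two of the nonzero terms have a
nonzero sum. -/
lemma exists_pair_add_ne_zero {ι : Type*} [Fintype ι] (h2 : (2 : F) ≠ 0) (t : ι → F)
    (hsum : ∑ i, t i ≠ 0) {i j : ι} (hij : i ≠ j) (hi : t i ≠ 0) (hj : t j ≠ 0) :
    ∃ k l, k ≠ l ∧ t k ≠ 0 ∧ t l ≠ 0 ∧ t k + t l ≠ 0 := by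
  by_contra! H
  have h1 := H i j hij hi hj
  -- Three nonzero terms with vanishing pairwise sums would give 2 * t k = 0; with only two such
  -- terms the total is t i + t j = 0.
  by_cases h3 : ∃ k, k ≠ i ∧ k ≠ j ∧ t k ≠ 0
  · obtain ⟨k, hki, hkj, hk⟩ := h3
    have h4 := H k i hki hk hi
    have h5 := H k j hkj hk hj
    have : 2 * t k = 0 := by linear_combination h4 + h5 - h1
    exact hk ((mul_eq_zero.1 this).resolve_left h2)
  · push Not at h3
    exact hsum ((Fintype.sum_eq_add i j hij fun k hk => h3 k hk.1 hk.2).trans h1)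

/-- Witt's chain equivalence: a function on units that is invariant under squares and under
isometries of binary forms has the same sum over any two diagonalizations. -/
theorem IsDiagonal.sum_eq {A : Type*} [AddCommGroup A] (h2 : (2 : F) ≠ 0) {f : Fˣ → A}
    (hsq : ∀ a b, f (a * b ^ 2) = f a)
    (hadd : ∀ a b c : Fˣ, (a : F) + b = c → f a + f b = f c + f (a * b * c)) :
    ∀ {n : ℕ} {e g : Fin n → V} {a b : Fin n → Fˣ}, B.IsDiagonal e a → B.IsDiagonal g b →
      (∀ k, g k ∈ Submodule.span F (Set.range e)) → ∑ i, f (a i) = ∑ i, f (b i) := by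
  intro n
  induction n with
  | zero => intros; simp
  | succ n ih =>
  intro e g a b he hg hspan
  obtain ⟨c, hc⟩ := (Submodule.mem_span_range_iff_exists_fun F).1 (hspan 0)
  classical
  -- Inner induction on the number of nonzero coordinates of `g 0` with respect to `e`. Once a
  -- single one remains, that vector can be split off and the outer induction applies.
  obtain ⟨m, hm⟩ : ∃ m, (Finset.univ.filter fun k => c k ≠ 0).card = m := ⟨_, rfl⟩
  induction m using Nat.strong_induction_on generalizing e a c with
  | _ m ihm =>
  have hb : (b 0 : F) = ∑ i, a i * c i ^ 2 := by rw [← hg.self 0, ← hc, he.sum_sum]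
  have hb0 : ∑ i, (a i : F) * c i ^ 2 ≠ 0 := hb ▸ (b 0).ne_zero
  obtain ⟨i, -, hi⟩ := Finset.exists_ne_zero_of_sum_ne_zero hb0
  have hci : c i ≠ 0 := by rintro h; simp [h] at hi
  by_cases hone : ∀ j, j ≠ i → c j = 0
  · have hg0 : g 0 = c i • e i := by
      rw [← hc, Fintype.sum_eq_single i fun j hj => by rw [hone j hj, zero_smul]]
    have hfi : f (b 0) = f (a i) := by
      have : b 0 = a i * (Units.mk0 (c i) hci) ^ 2 := by
        ext
        rw [hb, Fintype.sum_eq_single i fun j hj => by simp [hone j hj]]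
        simp
      rw [this, hsq]
    rw [Fin.sum_univ_succAbove _ i, Fin.sum_univ_succ, hfi]
    congr 1
    refine ih (he.comp i.succAbove_right_injective) (hg.comp (Fin.succ_injective n)) fun k => ?_
    obtain ⟨d, hd⟩ := (Submodule.mem_span_range_iff_exists_fun F).1 (hspan k.succ)
    -- The remaining vectors are orthogonal to `g 0`, a nonzero multiple of `e i`, so they have no
    -- component along `e i`.
    have hdi : d i = 0 := by
      have h1 := he.apply_sum d i
      have h3 : B (g k.succ) (g 0) = 0 := hg.of_ne (Fin.succ_ne_zero k)
      rw [hg0, map_smul, smul_eq_mul, ← hd, h1] at h3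
      simpa [hci] using h3
    refine (Submodule.mem_span_range_iff_exists_fun F).2 ⟨d ∘ i.succAbove, ?_⟩
    rw [Fin.sum_univ_succAbove _ i, hdi, zero_smul, zero_add] at hd
    exact hd
  · push Not at hone
    obtain ⟨j, hji, hcj⟩ := hone
    obtain ⟨i, j, hij, hi, hj, hsum⟩ := exists_pair_add_ne_zero h2 _ hb0 hji
      (mul_ne_zero (a j).ne_zero (pow_ne_zero 2 hcj)) hi
    have hci : c i ≠ 0 := by rintro h; simp [h] at hi
    have hcj : c j ≠ 0 := by rintro h; simp [h] at hj
    set γ : Fˣ := Units.mk0 _ hsum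
    have hγ : (γ : F) = a i * c i ^ 2 + a j * c j ^ 2 := rfl
    -- Rotating by the coordinates of `g 0` itself merges its two components into the new i-th
    -- vector: coordinate 1 at i and 0 at j, so the support shrinks.
    have hnew := ihm _ ?_ (he.rotate hij hγ)
      (fun k => IsDiagonal.span_le_span_rotate hij hγ (hspan k))
      (fun k => if k = i then 1 else if k = j then 0 else c k) ?_ rfl
    · rw [← hnew]
      refine Fintype.sum_eq_sum_of_pair hij (fun k hki hkj => by simp [hki, hkj]) ?_
      have h3 := hadd (a i * Units.mk0 _ hci ^ 2) (a j * Units.mk0 _ hcj ^ 2) γ (by simp [hγ])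
      have h4 : a i * Units.mk0 _ hci ^ 2 * (a j * Units.mk0 _ hcj ^ 2) * γ =
          a i * a j * γ * (Units.mk0 _ hci * Units.mk0 _ hcj) ^ 2 := by
        rw [mul_pow]; ac_rfl
      rw [hsq, hsq, h4, hsq] at h3
      simpa [hij.symm] using h3
    · rw [← hm]
      refine Finset.card_lt_card (Finset.ssubset_iff_of_subset ?_ |>.2 ⟨j, ?_, ?_⟩)
      · intro k
        by_cases hki : k = i
        · subst hki; simp [hci]
        by_cases hkj : k = j <;> simp [hki, hkj, hij.symm]
      · simpa using hcj
      · simp [hij.symm]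
    · rw [← hc]
      refine Fintype.sum_eq_sum_of_pair hij (fun k hki hkj => by simp [hki, hkj]) ?_
      simp [hij.symm]

/-- A nondegenerate symmetric bilinear form has a diagonalization. -/
lemma exists_isDiagonal [FiniteDimensional F V] (h2 : (2 : F) ≠ 0)
    (hs : ∀ x y, B x y = B y x) (hB : B.Nondegenerate) :
    ∃ (e : Module.Basis (Fin (Module.finrank F V)) F V) (a : Fin (Module.finrank F V) → Fˣ),
      B.IsDiagonal e a := by
  have : Invertible (2 : F) := invertibleOfNonzero h2
  obtain ⟨e, he⟩ := LinearMap.BilinForm.exists_orthogonal_basis (B := B) ⟨hs⟩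
  have h0 : ∀ i, B (e i) (e i) ≠ 0 := he.not_isOrtho_basis_self_of_separatingLeft hB.1
  exact ⟨e, fun i => Units.mk0 _ (h0 i), IsDiagonal.mk' (fun _ => rfl) fun i j hij => he hij⟩

end LinearMap.BilinForm

/-! ### The universal property of the Grothendieck-Witt ring -/

namespace BilinSpace

variable {F : Type u} [Field F]

lemma diag_form (a : Fˣ) (x y : F) : (diag a).form x y = a * (x * y) := rfl

/-- The diagonal bilinear form with entries `a₁, …, aₙ` on `Fⁿ`. -/
def piForm {n : ℕ} (a : Fin n → Fˣ) : LinearMap.BilinForm F (Fin n → F) :=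
  ∑ i, (a i : F) • (LinearMap.mul F F).compl₁₂ (LinearMap.proj i) (LinearMap.proj i)

lemma piForm_apply {n : ℕ} (a : Fin n → Fˣ) (x y : Fin n → F) :
    piForm a x y = ∑ i, a i * (x i * y i) := by
  simp [piForm, LinearMap.sum_apply]

/-- The diagonal space `⟨a₁, …, aₙ⟩`. -/
def pi {n : ℕ} (a : Fin n → Fˣ) : BilinSpace F where
  V := Fin n → F
  form := piForm a
  symm := fun x y => by simp [piForm_apply, mul_comm]
  nondeg := nondegenerate_of_left (fun x y => by simp [piForm_apply, mul_comm]) fun x hx => by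
    ext i
    simpa [piForm_apply, Pi.single_apply] using hx (Pi.single i 1)

lemma pi_zero (a : Fin 0 → Fˣ) : Isometric (pi a) (zero F) := by
  have : Subsingleton (pi a).V := inferInstanceAs (Subsingleton (Fin 0 → F))
  have : Subsingleton (zero F).V := inferInstanceAs (Subsingleton PUnit)
  refine ⟨⟨0, 0, fun _ => Subsingleton.elim _ _, fun _ => Subsingleton.elim _ _⟩, fun x y => ?_⟩
  rw [Subsingleton.elim x 0]
  simp

lemma pi_succ {n : ℕ} (a : Fin (n + 1) → Fˣ) :
    Isometric ((diag (a 0)).sum (pi (a ∘ Fin.succ))) (pi a) := by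
  refine ⟨Fin.consLinearEquiv F fun _ : Fin (n + 1) => F, fun x y => ?_⟩
  refine (piForm_apply a _ _).trans ?_
  rw [Fin.sum_univ_succ]
  exact congrArg₂ (· + ·) rfl (piForm_apply (a ∘ Fin.succ) x.2 y.2).symm

lemma isometric_pi (A : BilinSpace F) {n : ℕ} (e : Module.Basis (Fin n) F A.V) (a : Fin n → Fˣ)
    (h : A.form.IsDiagonal e a) : Isometric A (pi a) := by
  refine ⟨e.equivFun, fun x y => (piForm_apply a _ _).trans ?_⟩
  conv_rhs => rw [← e.sum_equivFun x, ← e.sum_equivFun y]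
  rw [map_sum]
  refine Finset.sum_congr rfl fun j _ => ?_
  rw [map_smul, h.apply_sum, smul_eq_mul]
  change (a j : F) * (e.equivFun x j * e.equivFun y j) = _
  ring

/-- The sum of the values of `f` on the entries of a diagonalization. -/
def diagSum (h2 : (2 : F) ≠ 0) {M : Type*} [AddCommGroup M] (f : Fˣ → M) (A : BilinSpace F) : M :=
  ∑ i, f ((LinearMap.BilinForm.exists_isDiagonal h2 A.symm A.nondeg).choose_spec.choose i)

section diagSum

variable {h2 : (2 : F) ≠ 0} {M : Type*} [AddCommGroup M] {f : Fˣ → M}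

/-- By chain equivalence the chosen diagonalization does not matter. Spanning is not required of
`g`, since the chosen family is a basis; a general index type allows disjoint unions for orthogonal
sums. -/
lemma diagSum_eq
    (hsq : ∀ a b, f (a * b ^ 2) = f a)
    (hadd : ∀ a b c : Fˣ, (a : F) + b = c → f a + f b = f c + f (a * b * c))
    {A : BilinSpace F} {κ : Type*} [Fintype κ]
    (hκ : Fintype.card κ = Module.finrank F A.V) {g : κ → A.V} {b : κ → Fˣ}
    (hg : A.form.IsDiagonal g b) : diagSum h2 f A = ∑ i, f (b i) := by
  let s := (Fintype.equivFinOfCardEq hκ).symm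
  rw [← s.sum_comp]
  refine LinearMap.BilinForm.IsDiagonal.sum_eq h2 hsq hadd
    (LinearMap.BilinForm.exists_isDiagonal h2 A.symm A.nondeg).choose_spec.choose_spec
    (hg.comp s.injective) fun k => ?_
  rw [Module.Basis.span_eq]
  trivial

lemma exists_diagSum_eq
    (hsq : ∀ a b, f (a * b ^ 2) = f a)
    (hadd : ∀ a b c : Fˣ, (a : F) + b = c → f a + f b = f c + f (a * b * c))
    (A : BilinSpace F) :
    ∃ (g : Fin (Module.finrank F A.V) → A.V) (b : Fin (Module.finrank F A.V) → Fˣ),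
      A.form.IsDiagonal g b ∧ diagSum h2 f A = ∑ i, f (b i) :=
  let ⟨_, b, hb⟩ := LinearMap.BilinForm.exists_isDiagonal h2 A.symm A.nondeg
  ⟨_, b, hb, diagSum_eq hsq hadd (Fintype.card_fin _) hb⟩

lemma diagSum_congr
    (hsq : ∀ a b, f (a * b ^ 2) = f a)
    (hadd : ∀ a b c : Fˣ, (a : F) + b = c → f a + f b = f c + f (a * b * c))
    {A B : BilinSpace F} (h : Isometric A B) :
    diagSum h2 f A = diagSum h2 f B := by
  obtain ⟨g, b, hg, hb⟩ := exists_diagSum_eq (h2 := h2) hsq hadd A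
  obtain ⟨e, he⟩ := h
  have hg' : B.form.IsDiagonal (fun i => e (g i)) b := fun i j => (he _ _).trans (hg i j)
  rw [hb, diagSum_eq hsq hadd ((Fintype.card_fin _).trans e.finrank_eq) hg']

lemma diagSum_zero
    (hsq : ∀ a b, f (a * b ^ 2) = f a)
    (hadd : ∀ a b c : Fˣ, (a : F) + b = c → f a + f b = f c + f (a * b * c)) :
    diagSum h2 f (zero F) = 0 := by
  have h : (zero F).form.IsDiagonal (Empty.elim : Empty → (zero F).V) Empty.elim := fun i => i.elim
  have hc : Fintype.card Empty = Module.finrank F (zero F).V :=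
    (Module.finrank_zero_of_subsingleton (R := F) (M := (PUnit : Type u))).symm
  rw [diagSum_eq hsq hadd hc h]
  simp

lemma diagSum_diag
    (hsq : ∀ a b, f (a * b ^ 2) = f a)
    (hadd : ∀ a b c : Fˣ, (a : F) + b = c → f a + f b = f c + f (a * b * c))
    (a : Fˣ) : diagSum h2 f (diag a) = f a := by
  have h : (diag a).form.IsDiagonal (fun _ : Unit => (1 : F)) (fun _ => a) := fun i j => by
    simp [diag_form]
  have hc : Fintype.card Unit = Module.finrank F (diag a).V := (Module.finrank_self F).symm
  rw [diagSum_eq hsq hadd hc h]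
  simp

lemma diagSum_sum
    (hsq : ∀ a b, f (a * b ^ 2) = f a)
    (hadd : ∀ a b c : Fˣ, (a : F) + b = c → f a + f b = f c + f (a * b * c))
    (A B : BilinSpace F) :
    diagSum h2 f (A.sum B) = diagSum h2 f A + diagSum h2 f B := by
  obtain ⟨g, b, hg, hb⟩ := exists_diagSum_eq (h2 := h2) hsq hadd A
  obtain ⟨g', b', hg', hb'⟩ := exists_diagSum_eq (h2 := h2) hsq hadd B
  have h : (A.sum B).form.IsDiagonal
      (Sum.elim (fun i => (g i, (0 : B.V))) fun j => ((0 : A.V), g' j)) (Sum.elim b b') := by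
    rintro (i | i) (j | j) <;> refine (sum_form A B _ _).trans ?_
    · change A.form (g i) (g j) + B.form 0 0 = _
      simp [hg _ _]
    · change A.form (g i) 0 + B.form 0 (g' j) = _
      simp
    · change A.form 0 (g j) + B.form (g' i) 0 = _
      simp
    · change A.form 0 0 + B.form (g' i) (g' j) = _
      simp [hg' _ _]
  have hc : Fintype.card (Fin (Module.finrank F A.V) ⊕ Fin (Module.finrank F B.V)) =
      Module.finrank F (A.sum B).V := by
    rw [Fintype.card_sum, Fintype.card_fin, Fintype.card_fin]
    exact (Module.finrank_prod (R := F) (M := A.V) (M' := B.V)).symm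
  rw [hb, hb', diagSum_eq hsq hadd hc h, Fintype.sum_sum_type]
  rfl

end diagSum

/-- The isometry `⟨a⟩ ⊥ ⟨b⟩ ≅ ⟨c⟩ ⊥ ⟨abc⟩` for `a + b = c`. -/
lemma diag_sum_diag {a b c : Fˣ} (h : (a : F) + b = c) :
    Isometric ((diag a).sum (diag b)) ((diag c).sum (diag (a * b * c))) := by
  have hc : (c : F) ≠ 0 := c.ne_zero
  -- Coordinates in the orthogonal basis (1, 1), (b, -a), whose values are a + b = c and ab² + ba² =
  -- abc.
  let e : (F × F) ≃ₗ[F] (F × F) :=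
    { toFun := fun x => ((a * x.1 + b * x.2) / c, (x.1 - x.2) / c)
      invFun := fun y => (y.1 + b * y.2, y.1 - a * y.2)
      map_add' := fun x y => by ext <;> simp <;> ring
      map_smul' := fun r x => by ext <;> simp <;> ring
      left_inv := fun x => by
        ext <;> simp <;> field_simp <;> rw [← h] <;> ring
      right_inv := fun y => by
        ext <;> simp <;> field_simp <;> rw [← h] <;> ring }
  refine ⟨e, fun (x : F × F) (y : F × F) => ?_⟩
  change (c : F) * ((a * x.1 + b * x.2) / c * ((a * y.1 + b * y.2) / c)) +
    ((a * b * c : Fˣ) : F) * ((x.1 - x.2) / c * ((y.1 - y.2) / c)) =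
      a * (x.1 * y.1) + b * (x.2 * y.2)
  push_cast
  field_simp
  rw [← h]
  ring

lemma diag_mul_sq (a b : Fˣ) : Isometric (diag (a * b ^ 2)) (diag a) := by
  refine ⟨LinearEquiv.smulOfUnit b, fun (x y : F) => ?_⟩
  change (a : F) * ((b * x) * (b * y)) = ((a * b ^ 2 : Fˣ) : F) * (x * y)
  push_cast
  ring

lemma diag_tensor_diag (a b : Fˣ) : Isometric ((diag a).tensor (diag b)) (diag (a * b)) := by
  refine isometric_of_tmul (A := diag a) (B := diag b) (C := diag (a * b))
    (TensorProduct.lid F F) fun (x y z w : F) => ?_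
  change ((a * b : Fˣ) : F) * ((x • z) * (y • w)) = a * (x * y) * (b * (z * w))
  simp only [smul_eq_mul]
  push_cast
  ring

end BilinSpace

namespace GW

variable {F : Type u} [Field F]

lemma ofClass_mk_sum (A B : BilinSpace F) : ofClass (BilinClass.mk (A.sum B)) =
    ofClass (BilinClass.mk A) + ofClass (BilinClass.mk B) :=
  map_add ofClass (BilinClass.mk A) (BilinClass.mk B)

lemma diag_one : diag (1 : Fˣ) = 1 := rfl

lemma diag_mul (a b : Fˣ) : diag (a * b) = diag a * diag b := by
  rw [diag, diag, diag, ← ofClass_mul]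
  exact congrArg ofClass (BilinClass.sound (BilinSpace.diag_tensor_diag a b)).symm

lemma diag_mul_sq (a b : Fˣ) : diag (a * b ^ 2) = diag a :=
  congrArg ofClass (BilinClass.sound (BilinSpace.diag_mul_sq a b))

lemma diag_mul_self (a : Fˣ) : diag a * diag a = 1 := by
  rw [← diag_mul, ← diag_one, ← diag_mul_sq 1 a, one_mul, sq]

lemma diag_add_diag {a b c : Fˣ} (h : (a : F) + b = c) :
    diag a + diag b = diag c + diag (a * b * c) := by
  have h1 := congrArg ofClass (BilinClass.sound (BilinSpace.diag_sum_diag h))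
  rwa [ofClass_mk_sum, ofClass_mk_sum] at h1

lemma diag_add_diag_of_add_eq_one {a b : Fˣ} (h : (a : F) + b = 1) :
    diag a + diag b = 1 + diag a * diag b := by
  rw [diag_add_diag (c := 1) (by simpa using h), mul_one, diag_mul, diag_one]

lemma ofClass_mem_closure (h2 : (2 : F) ≠ 0) (x : BilinClass F) :
    ofClass x ∈ AddSubmonoid.closure (Set.range (diag : Fˣ → GW F)) := by
  induction x using Quotient.inductionOn with
  | _ A =>
  obtain ⟨e, a, h⟩ := LinearMap.BilinForm.exists_isDiagonal h2 A.symm A.nondeg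
  change ofClass (BilinClass.mk A) ∈ _
  rw [BilinClass.sound (A.isometric_pi e a h)]
  clear h e
  generalize Module.finrank F A.V = n at a
  induction n with
  | zero =>
    rw [BilinClass.sound (BilinSpace.pi_zero a)]
    exact (map_zero (ofClass (F := F))).symm ▸ zero_mem _
  | succ n ih =>
    rw [← BilinClass.sound (BilinSpace.pi_succ a), ofClass_mk_sum]
    exact add_mem (AddSubmonoid.subset_closure ⟨_, rfl⟩) (ih _)

/-- `GW(F)` is additively generated by the classes `⟨a⟩`. -/
lemma closure_range_diag (h2 : (2 : F) ≠ 0) :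
    AddSubgroup.closure (Set.range (diag : Fˣ → GW F)) = ⊤ := by
  refine (AddSubgroup.eq_top_iff' _).2 fun x => ?_
  obtain ⟨a, b, rfl⟩ := exists_eq_sub x
  exact sub_mem (AddSubgroup.le_closure_toAddSubmonoid _ (ofClass_mem_closure h2 a))
    (AddSubgroup.le_closure_toAddSubmonoid _ (ofClass_mem_closure h2 b))

lemma diag_induction (h2 : (2 : F) ≠ 0) {p : GW F → Prop} (diag : ∀ a, p (diag a))
    (zero : p 0) (add : ∀ x y, p x → p y → p (x + y)) (neg : ∀ x, p x → p (-x)) (x : GW F) :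
    p x := by
  have hx : x ∈ AddSubgroup.closure (Set.range (GW.diag : Fˣ → GW F)) := by
    rw [closure_range_diag h2]; trivial
  induction hx using AddSubgroup.closure_induction with
  | mem x h => obtain ⟨a, rfl⟩ := h; exact diag a
  | zero => exact zero
  | add x y _ _ hx hy => exact add x y hx hy
  | neg x _ hx => exact neg x hx

/-- A function on units invariant under squares and binary isometries extends additively
to `GW(F)`. -/
def liftDiagAdd (h2 : (2 : F) ≠ 0) {M : Type*} [AddCommGroup M] (f : Fˣ → M)
    (hsq : ∀ a b, f (a * b ^ 2) = f a)
    (hadd : ∀ a b c : Fˣ, (a : F) + b = c → f a + f b = f c + f (a * b * c)) : GW F →+ M :=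
  liftAdd
    { toFun := Quotient.lift (BilinSpace.diagSum h2 f)
        fun _ _ h => BilinSpace.diagSum_congr hsq hadd h
      map_zero' := BilinSpace.diagSum_zero hsq hadd
      map_add' := fun x y => Quotient.inductionOn₂ x y fun A B =>
        BilinSpace.diagSum_sum hsq hadd A B }

lemma liftDiagAdd_diag (h2 : (2 : F) ≠ 0) {M : Type*} [AddCommGroup M] {f : Fˣ → M}
    (hsq : ∀ a b, f (a * b ^ 2) = f a)
    (hadd : ∀ a b c : Fˣ, (a : F) + b = c → f a + f b = f c + f (a * b * c)) (a : Fˣ) :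
    liftDiagAdd h2 f hsq hadd (diag a) = f a :=
  (liftAdd_ofClass _ _).trans (BilinSpace.diagSum_diag (h2 := h2) hsq hadd a)

/-- Presentation of `GW(F)` as a ring: a homomorphism from units to a ring that is trivial on
squares and satisfies `f a + f b = 1 + f a * f b` for `a + b = 1` extends to `GW(F)`. -/
theorem exists_ringHom (h2 : (2 : F) ≠ 0) {R : Type*} [Ring R] (f : Fˣ →* R)
    (hsq : ∀ b, f (b ^ 2) = 1)
    (hadd : ∀ a b : Fˣ, (a : F) + b = 1 → f a + f b = 1 + f a * f b) :
    ∃ φ : GW F →+* R, ∀ a, φ (diag a) = f a := by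
  have hsq' : ∀ a b, f (a * b ^ 2) = f a := fun a b => by rw [map_mul, hsq, mul_one]
  have hadd' : ∀ a b c : Fˣ, (a : F) + b = c → f a + f b = f c + f (a * b * c) := by
    intro a b c h
    -- Dividing by c reduces to a + b = 1; multiplying back by `f c` leaves only square factors to
    -- discard.
    have h1 := hadd (c⁻¹ * a) (c⁻¹ * b) (by
      push_cast
      rw [← mul_add, h, inv_mul_cancel₀ c.ne_zero])
    have h3 : c * (c⁻¹ * a * (c⁻¹ * b)) = a * b * c * (c⁻¹) ^ 2 := by
      rw [sq]; ac_rfl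
    have h4 := congrArg (f c * ·) h1
    simp only [mul_add, mul_one, ← map_mul, mul_inv_cancel_left] at h4
    rw [h4, h3, hsq']
  let φ := liftDiagAdd h2 f hsq' hadd'
  have hφ : ∀ a, φ (diag a) = f a := liftDiagAdd_diag h2 hsq' hadd'
  refine ⟨{ φ with map_one' := (hφ 1).trans (map_one f), map_mul' := fun x y => ?_ }, hφ⟩
  change φ (x * y) = φ x * φ y
  induction x using diag_induction h2 with
  | zero => simp
  | add x x' h h' => rw [add_mul, map_add, map_add, h, h', add_mul]
  | neg x h => rw [neg_mul, map_neg, map_neg, h, neg_mul]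
  | diag a =>
    induction y using diag_induction h2 with
    | zero => simp
    | add x x' h h' => rw [mul_add, map_add, map_add, h, h', mul_add]
    | neg x h => rw [mul_neg, map_neg, map_neg, h, mul_neg]
    | diag b => rw [← diag_mul, hφ, hφ, hφ, map_mul]

/-- Hyperbolic planes are isometric: `⟨a⟩ + ⟨-a⟩ = ⟨1⟩ + ⟨-1⟩`. -/
lemma diag_mul_hyp (h2 : (2 : F) ≠ 0) (a : Fˣ) : diag a * hyp F = hyp F := by
  rw [hyp, mul_add, ← diag_mul, ← diag_mul, mul_one]
  by_cases h1 : (a : F) = 1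
  · rw [Units.val_eq_one.1 h1, one_mul]
  by_cases h1' : (a : F) = -1
  · have : a = -1 := by ext; simpa using h1'
    rw [this, neg_mul_neg, one_mul, add_comm]
  -- The form ⟨1⟩ + ⟨-1⟩ represents a, since a = ((a + 1)/2)² - ((a - 1)/2)². Both squares are units
  -- because a ≠ ±1.
  have hp : ((a : F) + 1) / 2 ≠ 0 := div_ne_zero (fun h => h1' (eq_neg_of_add_eq_zero_left h)) h2
  have hq : ((a : F) - 1) / 2 ≠ 0 := div_ne_zero (sub_ne_zero.2 h1) h2
  have h := diag_add_diag (a := 1 * Units.mk0 _ hp ^ 2) (b := -1 * Units.mk0 _ hq ^ 2) (c := a) (by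
    simp only [Units.val_mul, Units.val_neg, Units.val_pow_eq_pow_val, Units.val_mk0, Units.val_one]
    field_simp
    ring)
  have h3 : 1 * Units.mk0 _ hp ^ 2 * (-1 * Units.mk0 _ hq ^ 2) * a =
      a * -1 * (Units.mk0 _ hp * Units.mk0 _ hq) ^ 2 := by
    rw [mul_pow, one_mul]; ac_rfl
  rw [diag_mul_sq, diag_mul_sq, h3, diag_mul_sq] at h
  exact h.symm

/-- Consequently the ideal generated by the hyperbolic plane is just its integer multiples, on which
the rank is injective. -/
lemma mul_hyp (h2 : (2 : F) ≠ 0) (x : GW F) : x * hyp F = rank F x * hyp F := by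
  induction x using diag_induction h2 with
  | zero => simp
  | add x y hx hy => rw [add_mul, hx, hy, map_add, Int.cast_add, add_mul]
  | neg x hx => rw [neg_mul, hx, map_neg, Int.cast_neg, neg_mul]
  | diag a => rw [diag_mul_hyp h2, rank_diag, Int.cast_one, one_mul]

/-- An element of `GW(F)` is determined by its Witt class and its rank. -/
lemma eq_zero_of_proj_of_rank (h2 : (2 : F) ≠ 0) {x : GW F} (h : Witt.proj F x = 0)
    (hr : rank F x = 0) : x = 0 := by
  obtain ⟨y, rfl⟩ := Ideal.mem_span_singleton'.1 (Ideal.Quotient.eq_zero_iff_mem.1 h)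
  rw [map_mul, rank_hyp] at hr
  rw [mul_hyp h2, (mul_eq_zero.1 hr).resolve_right two_ne_zero, Int.cast_zero, zero_mul]

end GW

/-! ### Torsion and nilpotents in the Witt ring -/

namespace Witt

variable {F : Type u} [Field F]

/-- The Witt class of the form `⟨a⟩`. -/
def diag (a : Fˣ) : Witt F := proj F (GW.diag a)

lemma diag_one : diag (1 : Fˣ) = 1 := by rw [diag, GW.diag_one, map_one]

lemma diag_mul (a b : Fˣ) : diag (a * b) = diag a * diag b := by
  rw [diag, GW.diag_mul, map_mul]; rfl

lemma diag_mul_self (a : Fˣ) : diag a * diag a = 1 := by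
  rw [diag, ← map_mul, GW.diag_mul_self, map_one]

lemma diag_add_diag_of_add_eq_one {a b : Fˣ} (h : (a : F) + b = 1) :
    diag a + diag b = 1 + diag a * diag b := by
  rw [diag, diag, ← map_add, GW.diag_add_diag_of_add_eq_one h, map_add, map_mul, map_one]

lemma one_add_diag_neg_one : 1 + diag (-1 : Fˣ) = 0 := by
  rw [← diag_one, diag, diag, ← map_add]
  exact Ideal.Quotient.eq_zero_iff_mem.2 (Ideal.mem_span_singleton_self _)

lemma diag_induction (h2 : (2 : F) ≠ 0) {p : Witt F → Prop} (diag : ∀ a, p (diag a))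
    (zero : p 0) (add : ∀ x y, p x → p y → p (x + y)) (neg : ∀ x, p x → p (-x)) (x : Witt F) :
    p x := by
  obtain ⟨y, rfl⟩ := Ideal.Quotient.mk_surjective x
  induction y using GW.diag_induction h2 with
  | diag a => exact diag a
  | zero => rwa [map_zero]
  | add x y hx hy => rw [map_add]; exact add _ _ hx hy
  | neg x hx => rw [map_neg]; exact neg _ hx

/-- A prime ideal of the Witt ring not containing `2` comes from a signature `s`, and locally at
this prime ideal every element is equal to its signature. -/
lemma exists_signature (h2 : (2 : F) ≠ 0) (P : Ideal (Witt F)) [hP : P.IsPrime]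
    (hP2 : (2 : Witt F) ∉ P) :
    ∃ s : Witt F →+* ℤ, ∀ y, ∃ t ∉ P, t * y = t * (s y : Witt F) := by
  -- As ⟨a⟩² = 1, the prime P contains ⟨a⟩ - 1 or ⟨a⟩ + 1. It cannot contain both, since their
  -- difference is 2 up to sign.
  have hex : ∀ a : Fˣ, ∃ σ : ℤ, (σ = 1 ∨ σ = -1) ∧ diag a - (σ : Witt F) ∈ P := by
    intro a
    have h : (diag a - 1) * (diag a + 1) ∈ P := by
      have : (diag a - 1) * (diag a + 1) = 0 := by linear_combination diag_mul_self a
      rw [this]; exact zero_mem _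
    rcases hP.mem_or_mem h with h | h
    · exact ⟨1, Or.inl rfl, by simpa using h⟩
    · exact ⟨-1, Or.inr rfl, by simpa using h⟩
  choose σ hσ hσP using hex
  have huniq : ∀ (a : Fˣ) (τ : ℤ), (τ = 1 ∨ τ = -1) → diag a - (τ : Witt F) ∈ P → σ a = τ := by
    intro a τ hτ h
    have h3 := sub_mem h (hσP a)
    rw [sub_sub_sub_cancel_left] at h3
    rcases hσ a with h1 | h1 <;> rcases hτ with rfl | rfl <;> rw [h1] at h3 ⊢
    · refine absurd ?_ hP2
      convert h3 using 1
      norm_num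
    · refine absurd (neg_mem h3) (by norm_num; exact hP2)
  have hsq1 : ∀ a, σ a * σ a = 1 := fun a => by rcases hσ a with h | h <;> rw [h] <;> rfl
  have hone : σ 1 = 1 := huniq _ _ (Or.inl rfl) (by simp [diag_one])
  have hmul : ∀ a b, σ (a * b) = σ a * σ b := by
    intro a b
    refine huniq _ _ ?_ ?_
    · rcases hσ a with h | h <;> rcases hσ b with h' | h' <;> rw [h, h'] <;> simp
    · rw [diag_mul, Int.cast_mul]
      have := add_mem (P.mul_mem_right (diag b) (hσP a)) (P.mul_mem_left (σ a : Witt F) (hσP b))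
      convert this using 1
      ring
  obtain ⟨s, hs⟩ := GW.exists_ringHom h2 (R := ℤ) ⟨⟨σ, hone⟩, hmul⟩
    (fun b => by
      change σ (b ^ 2) = 1
      rw [sq, hmul, hsq1])
    (fun a b hab => by
      change σ a + σ b = 1 + σ a * σ b
      -- The relation (⟨a⟩ - 1)(⟨b⟩ - 1) = 0 with both signs -1 would read 4 ≡ 0 modulo P.
      have key : ¬ (σ a = -1 ∧ σ b = -1) := by
        rintro ⟨ha, hb⟩
        have h3 := hσP a
        have h4 := hσP b
        rw [ha] at h3
        rw [hb] at h4
        have h5 : (2 : Witt F) * 2 ∈ P := by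
          convert add_mem (P.mul_mem_right (1 - diag b) h3) (P.mul_mem_left 2 h4) using 1
          push_cast
          linear_combination -diag_add_diag_of_add_eq_one hab
        exact hP2 ((hP.mem_or_mem h5).elim id id)
      rcases hσ a with h | h <;> rcases hσ b with h' | h'
      · rw [h, h']; rfl
      · rw [h, h']; rfl
      · rw [h, h']; rfl
      · exact absurd ⟨h, h'⟩ key)
  have hs0 : ∀ x ∈ Ideal.span {GW.hyp F}, s x = 0 := by
    intro x hx
    obtain ⟨y, rfl⟩ := Ideal.mem_span_singleton'.1 hx
    have h3 : σ (-1) = -1 := huniq _ _ (Or.inr rfl) (by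
      have : diag (-1 : Fˣ) - ((-1 : ℤ) : Witt F) = 0 := by
        rw [← one_add_diag_neg_one]; push_cast; ring
      rw [this]; exact zero_mem _)
    have h4 : s (GW.hyp F) = σ 1 + σ (-1) := by
      rw [GW.hyp, map_add, hs, hs]; rfl
    rw [map_mul, h4, hone, h3]
    simp
  refine ⟨Ideal.Quotient.lift _ s hs0, fun y => ?_⟩
  induction y using diag_induction h2 with
  | diag a =>
    have h3 : Ideal.Quotient.lift _ s hs0 (diag a) = σ a :=
      (Ideal.Quotient.lift_mk _ _ _).trans (hs a)
    have h4 : (σ a : Witt F) * σ a = 1 := by rw [← Int.cast_mul, hsq1, Int.cast_one]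
    -- The complementary factor: its product with ⟨a⟩ - σ(a) is ⟨a⟩² - 1 = 0, while modulo P it
    -- equals 2σ(a), which is nonzero.
    refine ⟨diag a + σ a, fun ht => hP2 ?_, ?_⟩
    · have h5 := P.mul_mem_left (σ a : Witt F) (sub_mem ht (hσP a))
      convert h5 using 1
      linear_combination -2 * h4
    · rw [h3]
      linear_combination diag_mul_self a - h4
  | zero => exact ⟨1, (Ideal.ne_top_iff_one P).1 hP.ne_top, by simp⟩
  | add x y hx hy =>
    obtain ⟨t, ht, hx⟩ := hx
    obtain ⟨t', ht', hy⟩ := hy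
    refine ⟨t * t', fun h => (hP.mem_or_mem h).elim ht ht', ?_⟩
    rw [map_add, Int.cast_add]
    linear_combination t' * hx + t * hy
  | neg x hx =>
    obtain ⟨t, ht, hx⟩ := hx
    exact ⟨t, ht, by rw [map_neg, Int.cast_neg, mul_neg, mul_neg, hx]⟩

/-- An element of the Witt ring all of whose signatures vanish is `2`-primary torsion. -/
theorem exists_two_pow_mul_eq_zero (h2 : (2 : F) ≠ 0) {x : Witt F}
    (hx : ∀ s : Witt F →+* ℤ, s x = 0) : ∃ m : ℕ, 2 ^ m * x = 0 := by
  by_contra! H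
  -- If no power of 2 kills x, some prime contains the annihilator of x and avoids the powers of 2.
  -- Its signature then yields a t outside P with t * x = 0, a contradiction.
  obtain ⟨P, hP, hle, hdisj⟩ := Ideal.exists_le_prime_disjoint (Ideal.torsionOf (Witt F) (Witt F) x)
    (Submonoid.powers (2 : Witt F)) (by
      rw [Set.disjoint_left]
      rintro _ h ⟨m, rfl⟩
      exact H m ((Ideal.mem_torsionOf_iff _ _).1 h))
  obtain ⟨s, hs⟩ := exists_signature h2 P
    fun h => Set.disjoint_left.1 hdisj h (Submonoid.mem_powers _)
  obtain ⟨t, ht, h⟩ := hs x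
  rw [hx, Int.cast_zero, mul_zero] at h
  exact ht (hle ((Ideal.mem_torsionOf_iff _ _).2 h))

lemma map_eq_zero_of_isOfFinAddOrder {x : Witt F} (hx : IsOfFinAddOrder x) (s : Witt F →+* ℤ) :
    s x = 0 := by
  obtain ⟨n, hn, h⟩ := isOfFinAddOrder_iff_nsmul_eq_zero.1 hx
  have h1 : n • s x = 0 := by rw [← map_nsmul, h, map_zero]
  exact (smul_eq_zero.1 h1).resolve_left hn.ne'

lemma isOfFinAddOrder_of_two_pow_mul {x : Witt F} {m : ℕ} (h : 2 ^ m * x = 0) :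
    IsOfFinAddOrder x :=
  isOfFinAddOrder_iff_nsmul_eq_zero.2 ⟨2 ^ m, by positivity, by simpa [nsmul_eq_mul] using h⟩

/-- Torsion in the Witt ring is `2`-primary. -/
theorem two_primary_of_isOfFinAddOrder (h2 : (2 : F) ≠ 0) {x : Witt F} (hx : IsOfFinAddOrder x) :
    ∃ m : ℕ, 2 ^ m * x = 0 :=
  exists_two_pow_mul_eq_zero h2 (map_eq_zero_of_isOfFinAddOrder hx)

lemma isOfFinAddOrder_of_isNilpotent (h2 : (2 : F) ≠ 0) {x : Witt F} (hx : IsNilpotent x) :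
    IsOfFinAddOrder x :=
  let ⟨_, hm⟩ := exists_two_pow_mul_eq_zero h2 fun s => (hx.map s).eq_zero
  isOfFinAddOrder_of_two_pow_mul hm

/-- A prime ideal of the Witt ring containing `2` contains all elements of even rank. -/
lemma mem_of_two_mem_of_rank_eq_zero (h2 : (2 : F) ≠ 0) {P : Ideal (Witt F)} [hP : P.IsPrime]
    (hP2 : (2 : Witt F) ∈ P) {x : Witt F} (hx : rank F x = 0) : x ∈ P := by
  obtain ⟨y, rfl⟩ := Ideal.Quotient.mk_surjective x
  have key : proj F y - (GW.rank F y : Witt F) ∈ P := by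
    clear hx
    induction y using GW.diag_induction h2 with
    | diag a =>
      rw [GW.rank_diag, Int.cast_one]
      -- (⟨a⟩ - 1)² = 2(1 - ⟨a⟩) lies in P, so ⟨a⟩ ≡ 1 and every class is congruent to its rank.
      refine hP.mem_of_pow_mem 2 ?_
      convert P.mul_mem_right (1 - diag a) hP2 using 1
      have h := diag_mul_self a
      rw [diag] at h ⊢
      linear_combination h
    | zero => simp
    | add x y hx hy =>
      convert add_mem hx hy using 1
      rw [map_add, map_add]; push_cast; ring
    | neg x hx =>
      convert neg_mem hx using 1
      rw [map_neg, map_neg]; push_cast; ring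
  have hx' : ((GW.rank F y : ℤ) : ZMod 2) = 0 := hx
  obtain ⟨k, hk⟩ := (ZMod.intCast_zmod_eq_zero_iff_dvd _ 2).1 hx'
  have h3 : (GW.rank F y : Witt F) ∈ P := by
    rw [hk]
    push_cast
    exact P.mul_mem_right _ hP2
  simpa using add_mem key h3

/-- Torsion elements of even rank in the Witt ring are nilpotent. -/
theorem isNilpotent_of_isOfFinAddOrder (h2 : (2 : F) ≠ 0) {x : Witt F} (hx : IsOfFinAddOrder x)
    (hr : rank F x = 0) : IsNilpotent x := by
  rw [nilpotent_iff_mem_prime]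
  intro P hP
  by_cases hP2 : (2 : Witt F) ∈ P
  · exact mem_of_two_mem_of_rank_eq_zero h2 hP2 hr
  · obtain ⟨s, hs⟩ := exists_signature h2 P hP2
    obtain ⟨t, ht, h⟩ := hs x
    rw [map_eq_zero_of_isOfFinAddOrder hx, Int.cast_zero, mul_zero] at h
    exact (hP.mem_or_mem (h ▸ zero_mem P : t * x ∈ P)).resolve_left ht

lemma isNilpotent_iff (h2 : (2 : F) ≠ 0) {x : Witt F} :
    IsNilpotent x ↔ IsOfFinAddOrder x ∧ rank F x = 0 :=
  ⟨fun h => ⟨isOfFinAddOrder_of_isNilpotent h2 h, (h.map (rank F)).eq_zero⟩,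
    fun h => isNilpotent_of_isOfFinAddOrder h2 h.1 h.2⟩

end Witt

namespace GW

variable {F : Type u} [Field F]

lemma isNilpotent_iff_isOfFinAddOrder (h2 : (2 : F) ≠ 0) {x : GW F} :
    IsNilpotent x ↔ IsOfFinAddOrder x := by
  constructor
  · intro h
    obtain ⟨n, hn, h1⟩ := isOfFinAddOrder_iff_nsmul_eq_zero.1
      (Witt.isOfFinAddOrder_of_isNilpotent h2 (h.map (Witt.proj F)))
    refine isOfFinAddOrder_iff_nsmul_eq_zero.2 ⟨n, hn, eq_zero_of_proj_of_rank h2 ?_ ?_⟩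
    · rw [map_nsmul, h1]
    · rw [map_nsmul, (h.map (rank F)).eq_zero, smul_zero]
  · intro h
    obtain ⟨n, hn, h1⟩ := isOfFinAddOrder_iff_nsmul_eq_zero.1 h
    have hr : rank F x = 0 := by
      have h3 : n • rank F x = 0 := by rw [← map_nsmul, h1, map_zero]
      exact (smul_eq_zero.1 h3).resolve_left hn.ne'
    have hr' : Witt.rank F (Witt.proj F x) = 0 := by
      change ((rank F x : ℤ) : ZMod 2) = 0
      rw [hr, Int.cast_zero]
    obtain ⟨k, hk⟩ := Witt.isNilpotent_of_isOfFinAddOrder h2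
      (isOfFinAddOrder_iff_nsmul_eq_zero.2 ⟨n, hn, by rw [← map_nsmul, h1, map_zero]⟩) hr'
    -- The exponent must be positive for the power of the rank, which is 0, to vanish.
    refine ⟨k + 1, eq_zero_of_proj_of_rank h2 ?_ ?_⟩
    · rw [map_pow, pow_succ, hk, zero_mul]
    · rw [map_pow, hr, zero_pow k.succ_ne_zero]

/-- Torsion in `GW(F)` is `2`-primary. -/
lemma two_primary_of_isOfFinAddOrder (h2 : (2 : F) ≠ 0) {x : GW F} (hx : IsOfFinAddOrder x) :
    ∃ m : ℕ, (2 ^ m : ℕ) • x = 0 := by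
  obtain ⟨m, hm⟩ := Witt.two_primary_of_isOfFinAddOrder h2
    ((Witt.proj F).toAddMonoidHom.isOfFinAddOrder hx)
  obtain ⟨n, hn, h1⟩ := isOfFinAddOrder_iff_nsmul_eq_zero.1 hx
  have hr : rank F x = 0 := by
    have h3 : n • rank F x = 0 := by rw [← map_nsmul, h1, map_zero]
    exact (smul_eq_zero.1 h3).resolve_left hn.ne'
  refine ⟨m, eq_zero_of_proj_of_rank h2 ?_ ?_⟩
  · rw [map_nsmul, nsmul_eq_mul]
    push_cast
    exact hm
  · rw [map_nsmul, hr, smul_zero]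

end GW

/-! ### Milnor-Witt K-theory in non-positive degrees -/

namespace KMW

variable {F : Type u} [Field F]

lemma symbol_mul_symbol_eq_zero {a b : Fˣ} (h : (a : F) + b = 1) : symbol a * symbol b = 0 := by
  have := RingQuot.mkAlgHom_rel ℤ (KMWRel.steinberg a b h)
  rwa [map_mul, map_zero] at this

lemma symbol_mul (a b : Fˣ) :
    symbol (a * b) = symbol a + symbol b + eta F * symbol a * symbol b := by
  have := RingQuot.mkAlgHom_rel ℤ (KMWRel.symbol_mul a b)
  rwa [map_add, map_add, map_mul, map_mul] at this

lemma symbol_mul_eta (a : Fˣ) : symbol a * eta F = eta F * symbol a := by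
  have := RingQuot.mkAlgHom_rel ℤ (KMWRel.eta_comm a)
  rwa [map_mul, map_mul] at this

lemma eta_mul_hyp : eta F * (eta F * symbol (-1) + 2) = 0 := by
  have := RingQuot.mkAlgHom_rel ℤ (KMWRel.eta_hyp (F := F))
  rwa [map_mul, map_add, map_mul, map_ofNat, map_zero] at this

/-- The universal property of the Milnor-Witt K-ring. -/
lemma exists_ringHom {R : Type*} [Ring R] (t : R) (s : Fˣ → R)
    (steinberg : ∀ a b : Fˣ, (a : F) + b = 1 → s a * s b = 0)
    (mul : ∀ a b, s (a * b) = s a + s b + t * s a * s b) (comm : ∀ a, s a * t = t * s a)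
    (hyp : t * (t * s (-1) + 2) = 0) :
    ∃ φ : KMW F →+* R, φ (eta F) = t ∧ ∀ a, φ (symbol a) = s a := by
  let g : KMWGen F → R := fun x => match x with
    | .eta => t
    | .symbol a => s a
  have hrel : ∀ ⦃x y⦄, KMWRel F x y → FreeAlgebra.lift ℤ g x = FreeAlgebra.lift ℤ g y := by
    rintro _ _ (⟨a, b, h⟩ | ⟨a, b⟩ | ⟨a⟩ | _)
    · simpa [g] using steinberg a b h
    · simpa [g] using mul a b
    · simpa [g] using comm a
    · rw [map_mul, map_add, map_mul, map_ofNat, map_zero]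
      simpa [g] using hyp
  refine ⟨(RingQuot.liftAlgHom ℤ ⟨FreeAlgebra.lift ℤ g, hrel⟩ : KMW F →ₐ[ℤ] R).toRingHom, ?_, ?_⟩
  · exact (RingQuot.liftAlgHom_mkAlgHom_apply ℤ _ hrel _).trans (FreeAlgebra.lift_ι_apply _ _)
  · intro a
    exact (RingQuot.liftAlgHom_mkAlgHom_apply ℤ _ hrel _).trans (FreeAlgebra.lift_ι_apply _ _)

lemma commute_eta (x : KMW F) : Commute (eta F) x := by
  obtain ⟨y, rfl⟩ := RingQuot.mkAlgHom_surjective ℤ (KMWRel F) x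
  induction y using FreeAlgebra.induction with
  | grade0 r => rw [AlgHom.commutes]; exact (Algebra.commutes r _).symm
  | grade1 g =>
    cases g with
    | eta => exact Commute.refl _
    | symbol a => exact (symbol_mul_eta a).symm
  | mul x y hx hy => rw [map_mul]; exact hx.mul_right hy
  | add x y hx hy => rw [map_add]; exact hx.add_right hy

/-! ### Relations of `GW(F)` among the elements 1 + η[a] -/

/-- The element `1 + η[a]`. -/
def angle (a : Fˣ) : KMW F := 1 + eta F * symbol a

lemma eta_mul_symbol (a : Fˣ) : eta F * symbol a = angle a - 1 := by simp [angle]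

lemma angle_mul (a b : Fˣ) : angle (a * b) = angle a * angle b := by
  have h : eta F * symbol a * (eta F * symbol b) = eta F * (eta F * symbol a * symbol b) := by
    rw [← mul_assoc, mul_assoc (eta F) (symbol a), symbol_mul_eta, mul_assoc]
  rw [angle, symbol_mul, angle, angle, mul_add, mul_add, ← h]
  noncomm_ring

/-- Expanding [(-1)(-1)] gives [1] = (η[-1] + 2)[-1], which η kills; then [1 · 1] = [1] + [1] forces
[1] = 0. -/
lemma symbol_one : symbol (1 : Fˣ) = 0 := by
  have h1 : symbol (1 : Fˣ) = (eta F * symbol (-1) + 2) * symbol (-1) := by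
    have := symbol_mul (-1 : Fˣ) (-1)
    rw [neg_mul_neg, one_mul] at this
    rw [this, add_mul, two_mul, add_comm]
  have h2 : eta F * symbol 1 = 0 := by rw [h1, ← mul_assoc, eta_mul_hyp, zero_mul]
  have h3 := symbol_mul (1 : Fˣ) 1
  rw [one_mul, h2, zero_mul, add_zero] at h3
  simpa using h3

lemma angle_one : angle (1 : Fˣ) = 1 := by rw [angle, symbol_one, mul_zero, add_zero]

lemma angle_sub_one_mul_angle_sub_one {a b : Fˣ} (h : (a : F) + b = 1) :
    (angle a - 1) * (angle b - 1 : KMW F) = 0 := by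
  rw [← eta_mul_symbol, ← eta_mul_symbol, ← mul_assoc, mul_assoc (eta F) (symbol a),
    symbol_mul_eta, mul_assoc, mul_assoc, symbol_mul_symbol_eq_zero h, mul_zero, mul_zero]

lemma angle_sub_one_mul_angle_neg_one (a : Fˣ) :
    (angle a - 1) * (angle (-1) + 1 : KMW F) = 0 := by
  have h : eta F * (angle (-1) + 1) = 0 := by
    rw [← eta_mul_hyp, angle, ← one_add_one_eq_two, add_comm 1, add_assoc]
  rw [← eta_mul_symbol, ← symbol_mul_eta, mul_assoc, h, mul_zero]

/-- The analogue of [a][-a] = 0. By the Steinberg relation ⟨a⟩ - 1 absorbs ⟨1 - a⟩ and ⟨1 - a⁻¹⟩ on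
the right, and -a = (1 - a)/(1 - a⁻¹). -/
lemma angle_sub_one_mul_angle_neg (a : Fˣ) :
    (angle a - 1) * (angle (-a)) = (angle a - 1 : KMW F) := by
  by_cases ha : (a : F) = 1
  · rw [Units.val_eq_one.1 ha, angle_one, sub_self, zero_mul]
  have hb : 1 - (a : F) ≠ 0 := sub_ne_zero.2 (Ne.symm ha)
  have hc : 1 - (a : F)⁻¹ ≠ 0 := sub_ne_zero.2 fun h => ha (inv_eq_one.1 h.symm)
  have h1 : (angle a - 1) * angle (Units.mk0 _ hb) = (angle a - 1 : KMW F) := by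
    have := angle_sub_one_mul_angle_sub_one (a := a) (b := Units.mk0 _ hb) (by simp)
    rwa [mul_sub, mul_one, sub_eq_zero] at this
  have h2 : (angle a - 1) * angle (Units.mk0 _ hc) = (angle a - 1 : KMW F) := by
    have h3 := angle_sub_one_mul_angle_sub_one (a := a⁻¹) (b := Units.mk0 _ hc) (by simp)
    have h4 : angle a * (angle a⁻¹ - 1) = (1 - angle a : KMW F) := by
      rw [mul_sub, ← angle_mul, mul_inv_cancel, angle_one, mul_one]
    have h5 : (1 - angle a) * (angle (Units.mk0 _ hc) - 1 : KMW F) = 0 := by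
      rw [← h4, mul_assoc, h3, mul_zero]
    rw [← sub_eq_zero, ← neg_eq_zero, ← h5]
    simp only [mul_sub, sub_mul, mul_one, one_mul]
    abel
  have h3 : -a * Units.mk0 _ hc = Units.mk0 _ hb := by
    ext
    have := a.ne_zero
    simp only [Units.val_mul, Units.val_neg, Units.val_mk0]
    field_simp
    ring
  have h4 : (angle a - 1) * angle (-a) * angle (Units.mk0 _ hc) =
      (angle a - 1) * (angle (Units.mk0 _ hc) : KMW F) := by
    rw [mul_assoc, ← angle_mul, h3, h1, h2]
  have h5 := congrArg (· * angle (Units.mk0 _ hc)⁻¹) h4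
  simpa only [mul_assoc, ← angle_mul, mul_inv_cancel, angle_one, mul_one] using h5

/-- Here ⟨a⟩ - 1 absorbs ⟨-a⟩ = ⟨-1⟩⟨a⟩, and ⟨-1⟩ acts on it from the right as -1. Hence -(⟨a⟩ -
1)⟨a⟩ = ⟨a⟩ - 1, that is, ⟨a⟩² = 1. -/
lemma angle_sq (a : Fˣ) : angle (a ^ 2) = (1 : KMW F) := by
  have key : ∀ {R : Type u} [Ring R] (x e : R), (x - 1) * (e * x) = x - 1 →
      (x - 1) * (e + 1) = 0 → x * x = 1 := by
    intro R _ x e h1 h2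
    rw [mul_add, mul_one] at h2
    rw [← mul_assoc, eq_neg_of_add_eq_zero_left h2, neg_mul, neg_eq_iff_add_eq_zero, sub_mul,
      one_mul, sub_add_sub_cancel] at h1
    exact sub_eq_zero.1 h1
  rw [sq, angle_mul]
  refine key _ (angle (-1)) ?_ (angle_sub_one_mul_angle_neg_one a)
  rw [← angle_mul, neg_one_mul, angle_sub_one_mul_angle_neg]

lemma angle_add_angle {a b : Fˣ} (h : (a : F) + b = 1) :
    (angle a + angle b : KMW F) = 1 + angle a * angle b := by
  rw [← sub_eq_zero, ← neg_eq_zero, ← angle_sub_one_mul_angle_sub_one h]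
  simp only [mul_sub, sub_mul, mul_one, one_mul]
  abel

/-- The homomorphism `GW(F) → K^MW_0(F)`. -/
lemma exists_ringHom_of_GW (h2 : (2 : F) ≠ 0) :
    ∃ ι : GW F →+* KMW F, ∀ a, ι (GW.diag a) = angle a :=
  GW.exists_ringHom h2 ⟨⟨angle, angle_one⟩, angle_mul⟩ angle_sq fun _ _ h => angle_add_angle h

/-- The homomorphism inverting `η`. -/
lemma exists_ringHom_laurent (F : Type u) [Field F] :
    ∃ ρ : KMW F →+* LaurentPolynomial (Witt F), ρ (eta F) = LaurentPolynomial.T 1 ∧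
      ∀ a, ρ (symbol a) = LaurentPolynomial.C (Witt.diag a - 1) * LaurentPolynomial.T (-1) := by
  have hT : (LaurentPolynomial.T 1 : LaurentPolynomial (Witt F)) *
      LaurentPolynomial.T (-1) = 1 := by
    rw [← LaurentPolynomial.T_add]; simp
  refine exists_ringHom _ _ ?_ ?_ (fun a => mul_comm _ _) ?_
  · intro a b h
    have h1 := congrArg (LaurentPolynomial.C (R := Witt F)) (Witt.diag_add_diag_of_add_eq_one h)
    simp only [map_add, map_mul, map_one, map_sub] at h1 ⊢
    linear_combination -LaurentPolynomial.T (-1) ^ 2 * h1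
  · intro a b
    rw [Witt.diag_mul]
    simp only [map_mul, map_one, map_sub]
    linear_combination -(LaurentPolynomial.C (Witt.diag a) - 1) *
      (LaurentPolynomial.C (Witt.diag b) - 1) * LaurentPolynomial.T (-1) * hT
  · have h1 := congrArg (LaurentPolynomial.C (R := Witt F)) Witt.one_add_diag_neg_one
    simp only [map_add, map_one, map_zero, map_sub] at h1 ⊢
    linear_combination LaurentPolynomial.T 1 * h1 + LaurentPolynomial.T 1 *
      (LaurentPolynomial.C (Witt.diag (-1)) - 1) * hT

/-- The projection to degree zero modulo `η`. -/
lemma exists_ringHom_int (F : Type u) [Field F] :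
    ∃ ρ : KMW F →+* ℤ, ρ (eta F) = 0 ∧ ∀ a, ρ (symbol a) = 0 :=
  exists_ringHom 0 0 (by simp) (by simp) (by simp) (by simp)

/-! ### Homogeneous elements of non-positive degree -/

/-- Every word in the generators is a power of `η` times a product of symbols. -/
lemma exists_prod_gen_eq (l : List (KMWGen F)) : ∃ (k : ℕ) (L : List Fˣ),
    (l.map gen).prod = eta F ^ k * (L.map symbol).prod ∧
      (l.map KMWGen.degree).sum = (L.length : ℤ) - k := by
  induction l with
  | nil => exact ⟨0, [], by simp⟩
  | cons g l ih =>
    obtain ⟨k, L, h, hd⟩ := ih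
    cases g with
    | eta =>
      refine ⟨k + 1, L, ?_, ?_⟩
      · rw [List.map_cons, List.prod_cons, h, pow_succ', mul_assoc]; rfl
      · rw [List.map_cons, List.sum_cons, hd, KMWGen.degree]; push_cast; ring
    | symbol a =>
      refine ⟨k, a :: L, ?_, ?_⟩
      · rw [List.map_cons, List.prod_cons, h, List.map_cons, List.prod_cons, ← mul_assoc,
          ← mul_assoc]
        exact congrArg (· * _) ((commute_eta (symbol a)).pow_left k).symm.eq
      · rw [List.map_cons, List.sum_cons, hd, KMWGen.degree, List.length_cons]; push_cast; ring

lemma gen_word_mem_homog (l : List (KMWGen F)) :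
    (l.map gen).prod ∈ homog F (l.map KMWGen.degree).sum :=
  AddSubgroup.subset_closure ⟨l, rfl, rfl⟩

lemma mul_eta_pow_mem_homog {x : KMW F} {m : ℤ} (hx : x ∈ homog F m) (n : ℕ) :
    x * eta F ^ n ∈ homog F (m - n) := by
  induction hx using AddSubgroup.closure_induction with
  | mem x h =>
    obtain ⟨l, rfl, rfl⟩ := h
    have := gen_word_mem_homog (l ++ List.replicate n (KMWGen.eta : KMWGen F))
    simpa [KMWGen.degree, sub_eq_add_neg, eta] using this
  | zero => rw [zero_mul]; exact zero_mem _
  | add x y _ _ hx hy => rw [add_mul]; exact add_mem hx hy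
  | neg x _ hx => exact (neg_mul x (eta F ^ n)).symm ▸ neg_mem hx

section

variable {ι : GW F →+* KMW F}

lemma map_mem_homog_zero (hι : ∀ a, ι (GW.diag a) = angle a)
    (h2 : (2 : F) ≠ 0) (y : GW F) : ι y ∈ homog F 0 := by
  induction y using GW.diag_induction h2 with
  | diag a =>
    rw [hι, angle]
    refine add_mem ?_ ?_
    · simpa using gen_word_mem_homog ([] : List (KMWGen F))
    · simpa [KMWGen.degree, eta, symbol] using gen_word_mem_homog [KMWGen.eta, KMWGen.symbol a]
  | zero => rw [map_zero]; exact zero_mem _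
  | add x y hx hy => rw [map_add]; exact add_mem hx hy
  | neg x hx => rw [map_neg]; exact neg_mem hx

/-- Pairing each symbol with one η turns the word into the product of the elements ⟨aᵢ⟩ - 1. -/
lemma exists_eta_pow_mul_prod_symbol (hι : ∀ a, ι (GW.diag a) = angle a)
    (L : List Fˣ) :
    ∃ y, eta F ^ L.length * (L.map symbol).prod = ι y := by
  induction L with
  | nil => exact ⟨1, by simp⟩
  | cons a L ih =>
    obtain ⟨y, hy⟩ := ih
    refine ⟨(GW.diag a - 1) * y, ?_⟩
    rw [map_mul, map_sub, hι, map_one, ← eta_mul_symbol, ← hy, List.length_cons, pow_succ',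
      List.map_cons, List.prod_cons, mul_assoc, mul_assoc, ← mul_assoc _ (symbol a),
      ((commute_eta (symbol a)).pow_left _).eq, mul_assoc]

/-- `K^MW_{-n}(F)` consists of the elements `ι y * η ^ n`. -/
lemma mem_homog_neg_iff (hι : ∀ a, ι (GW.diag a) = angle a)
    (h2 : (2 : F) ≠ 0) (n : ℕ) {x : KMW F} :
    x ∈ homog F (-(n : ℤ)) ↔ ∃ y, x = ι y * eta F ^ n := by
  constructor
  · intro hx
    induction hx using AddSubgroup.closure_induction with
    | mem x h =>
      obtain ⟨l, hl, rfl⟩ := h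
      obtain ⟨k, L, h, hd⟩ := exists_prod_gen_eq l
      obtain ⟨y, hy⟩ := exists_eta_pow_mul_prod_symbol hι L
      -- Degree -n leaves exactly n factors η after each symbol has taken one.
      have hk : k = n + L.length := by omega
      refine ⟨y, ?_⟩
      rw [h, hk, pow_add, mul_assoc, hy, ((commute_eta (ι y)).pow_left n).eq]
    | zero => exact ⟨0, by simp⟩
    | add x x' _ _ hx hx' =>
      obtain ⟨y, rfl⟩ := hx
      obtain ⟨y', rfl⟩ := hx'
      exact ⟨y + y', by rw [map_add, add_mul]⟩
    | neg x _ hx =>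
      obtain ⟨y, rfl⟩ := hx
      exact ⟨-y, by rw [map_neg]; exact (neg_mul (ι y) (eta F ^ n)).symm⟩
  · rintro ⟨y, rfl⟩
    simpa using mul_eta_pow_mem_homog (map_mem_homog_zero hι h2 y) n

lemma map_eq_C_proj (hι : ∀ a, ι (GW.diag a) = angle a)
    (h2 : (2 : F) ≠ 0) {ρ : KMW F →+* LaurentPolynomial (Witt F)}
    (hη : ρ (eta F) = LaurentPolynomial.T 1)
    (hs : ∀ a, ρ (symbol a) =
      LaurentPolynomial.C (Witt.diag a - 1) * LaurentPolynomial.T (-1)) (y : GW F) :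
    ρ (ι y) = LaurentPolynomial.C (Witt.proj F y) := by
  induction y using GW.diag_induction h2 with
  | diag a =>
    rw [hι, angle, map_add, map_one, map_mul, hη, hs, mul_left_comm, ← LaurentPolynomial.T_add,
      add_neg_cancel, LaurentPolynomial.T_zero, mul_one, map_sub, map_one, add_sub_cancel]
    rfl
  | zero => simp only [map_zero]
  | add x y hx hy => simp only [map_add, hx, hy]
  | neg x hx => simp only [map_neg, hx]

lemma map_eq_rank (hι : ∀ a, ι (GW.diag a) = angle a)
    (h2 : (2 : F) ≠ 0) {r : KMW F →+* ℤ} (hη : r (eta F) = 0) (y : GW F) :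
    r (ι y) = GW.rank F y := by
  induction y using GW.diag_induction h2 with
  | diag a => rw [hι, angle, map_add, map_one, map_mul, hη, zero_mul, add_zero, GW.rank_diag]
  | zero => simp only [map_zero]
  | add x y hx hy => simp only [map_add, hx, hy]
  | neg x hx => simp only [map_neg, hx]

/-- The homomorphisms `W(F) → K^MW_{-n}(F)`, `φ ↦ φ η ^ n`. -/
lemma exists_addMonoidHom_of_Witt (hι : ∀ a, ι (GW.diag a) = angle a)
    {n : ℕ} (hn : 1 ≤ n) :
    ∃ θ : Witt F →+ KMW F, ∀ x, θ (Witt.proj F x) = ι x * eta F ^ n := by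
  let g : GW F →+ KMW F := (AddMonoidHom.mulRight (eta F ^ n)).comp ι.toAddMonoidHom
  have hker : (Witt.proj F).toAddMonoidHom.ker ≤ g.ker := by
    intro x hx
    obtain ⟨y, rfl⟩ := Ideal.mem_span_singleton'.1 (Ideal.Quotient.eq_zero_iff_mem.1 hx)
    -- The hyperbolic plane maps to η[-1] + 2, which a single η annihilates; this is where n ≥ 1
    -- enters.
    have h1 : ι (GW.hyp F) = eta F * symbol (-1) + 2 := by
      rw [GW.hyp, map_add, hι, hι, angle_one, angle, ← one_add_one_eq_two]
      abel
    obtain ⟨m, rfl⟩ := Nat.exists_eq_add_of_le hn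
    change ι (y * GW.hyp F) * eta F ^ (1 + m) = 0
    rw [map_mul, mul_assoc, pow_add, pow_one, ← mul_assoc _ (eta F), h1,
      ← (commute_eta _).eq, eta_mul_hyp, zero_mul, mul_zero]
  have hsurj : Function.Surjective (Witt.proj F).toAddMonoidHom := Ideal.Quotient.mk_surjective
  exact ⟨AddMonoidHom.liftOfSurjective _ hsurj ⟨g, hker⟩, fun x =>
    AddMonoidHom.liftOfRightInverse_comp_apply _ _ _ ⟨g, hker⟩ x⟩

end

lemma theta_pow {ι : GW F →+* KMW F} {θ : ℕ → Witt F →+ KMW F}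
    (hθ : ∀ n, 1 ≤ n → ∀ x, θ n (Witt.proj F x) = ι x * eta F ^ n) {n k : ℕ} (hn : 1 ≤ n)
    (hk : 1 ≤ k) (φ : Witt F) : θ n φ ^ k = θ (n * k) (φ ^ k) := by
  obtain ⟨x, rfl⟩ := Ideal.Quotient.mk_surjective φ
  rw [← map_pow (Witt.proj F), hθ n hn, hθ (n * k) (Nat.mul_pos hn hk), map_pow, pow_mul,
    ((commute_eta (ι x)).symm.pow_right n).mul_pow]

/-- The sum of all homogeneous parts of non-positive degree, as a map from
`GW(F) ⊕ ⨁_{n ≥ 1} W(F)`. -/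
def nonposHom (ι : GW F →+* KMW F) (θ : ℕ → Witt F →+ KMW F) :
    GW F × (ℕ →₀ Witt F) →+ KMW F :=
  -- Index n stands for degree -(n + 1), because degree 0 is carried by `GW(F)`.
  ι.toAddMonoidHom.coprod (Finsupp.liftAddHom fun n => θ (n + 1))

section

variable {ι : GW F →+* KMW F} {θ : ℕ → Witt F →+ KMW F}

lemma map_theta_eq (hι : ∀ a, ι (GW.diag a) = angle a)
    (hθ : ∀ n, 1 ≤ n → ∀ x, θ n (Witt.proj F x) = ι x * eta F ^ n)
    (h2 : (2 : F) ≠ 0) {ρ : KMW F →+* LaurentPolynomial (Witt F)}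
    (hη : ρ (eta F) = LaurentPolynomial.T 1)
    (hs : ∀ a, ρ (symbol a) =
      LaurentPolynomial.C (Witt.diag a - 1) * LaurentPolynomial.T (-1)) {n : ℕ} (hn : 1 ≤ n)
    (φ : Witt F) : ρ (θ n φ) = LaurentPolynomial.C φ * LaurentPolynomial.T n := by
  obtain ⟨x, rfl⟩ := Ideal.Quotient.mk_surjective φ
  rw [hθ n hn, map_mul, map_pow, hη, map_eq_C_proj hι h2 hη hs, LaurentPolynomial.T_pow, mul_one]

/-- The Laurent coefficients recover each Witt component and the Witt class of y. With the former
zero, ι(y) = 0, and the map to ℤ gives rank 0, so y vanishes. -/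
lemma nonposHom_injective (hι : ∀ a, ι (GW.diag a) = angle a)
    (hθ : ∀ n, 1 ≤ n → ∀ x, θ n (Witt.proj F x) = ι x * eta F ^ n)
    (h2 : (2 : F) ≠ 0) : Function.Injective (nonposHom ι θ) := by
  rw [injective_iff_map_eq_zero]
  rintro ⟨y, φ⟩ h
  have h0 : ι y + φ.sum (fun n p => θ (n + 1) p) = 0 := h
  obtain ⟨ρ, hη, hs⟩ := exists_ringHom_laurent F
  obtain ⟨r, hr, -⟩ := exists_ringHom_int F
  have h1 : LaurentPolynomial.C (Witt.proj F y) +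
      φ.sum (fun n p => LaurentPolynomial.C p * LaurentPolynomial.T ((n + 1 : ℕ) : ℤ)) = 0 := by
    have := congrArg ρ h0
    rw [map_add, map_zero, map_eq_C_proj hι h2 hη hs, map_finsuppSum] at this
    rw [← this]
    congr 2
    ext1 n
    ext1 p
    rw [map_theta_eq hι hθ h2 hη hs n.succ_pos]
  have h1' : ∀ m : ℤ, (if m = 0 then Witt.proj F y else 0) +
      φ.sum (fun n p => if ((n + 1 : ℕ) : ℤ) = m then p else 0) = 0 := by
    intro m
    have := congrArg (fun f => f.coeff m) h1
    simp only [← LaurentPolynomial.single_eq_C_mul_T, AddMonoidAlgebra.coeff_add,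
      AddMonoidAlgebra.coeff_finsuppSum, AddMonoidAlgebra.coeff_single, Finsupp.add_apply,
      LaurentPolynomial.C_apply, AddMonoidAlgebra.coeff_zero, Finsupp.zero_apply,
      Finsupp.sum_apply, Finsupp.single_apply] at this
    exact this
  have hφ : φ = 0 := by
    ext n
    have := h1' ((n + 1 : ℕ) : ℤ)
    rw [if_neg (by positivity), zero_add] at this
    simpa [Finsupp.sum] using this
  subst hφ
  have hy : Witt.proj F y = 0 := by simpa using h1' 0
  rw [Finsupp.sum_zero_index, add_zero] at h0
  have hrank : GW.rank F y = 0 := by rw [← map_eq_rank hι h2 hr, h0, map_zero]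
  rw [GW.eq_zero_of_proj_of_rank h2 hy hrank]
  rfl

lemma nonpos_le_range (hι : ∀ a, ι (GW.diag a) = angle a)
    (hθ : ∀ n, 1 ≤ n → ∀ x, θ n (Witt.proj F x) = ι x * eta F ^ n)
    (h2 : (2 : F) ≠ 0) : nonpos F ≤ (nonposHom ι θ).range := by
  refine iSup₂_le fun m hm x hx => ?_
  obtain ⟨n, rfl⟩ : ∃ n : ℕ, m = -(n : ℤ) := ⟨m.natAbs, by omega⟩
  obtain ⟨y, rfl⟩ := (mem_homog_neg_iff hι h2 n).1 hx
  cases n with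
  | zero => exact ⟨(y, 0), by simp [nonposHom]⟩
  | succ n =>
    refine ⟨(0, Finsupp.single n (Witt.proj F y)), ?_⟩
    rw [← hθ (n + 1) n.succ_pos]
    simp [nonposHom]

/-- Torsion in non-positive degrees is `2`-primary. -/
theorem two_primary_of_mem_nonpos (hι : ∀ a, ι (GW.diag a) = angle a)
    (hθ : ∀ n, 1 ≤ n → ∀ x, θ n (Witt.proj F x) = ι x * eta F ^ n)
    (h2 : (2 : F) ≠ 0) {x : KMW F} (hx : x ∈ nonpos F)
    (ht : IsOfFinAddOrder x) : ∃ m : ℕ, (2 ^ m : ℕ) • x = 0 := by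
  obtain ⟨⟨y, φ⟩, rfl⟩ := nonpos_le_range hι hθ h2 hx
  obtain ⟨n, hn, h⟩ := isOfFinAddOrder_iff_nsmul_eq_zero.1 ht
  rw [← map_nsmul] at h
  have h1 := (injective_iff_map_eq_zero _).1 (nonposHom_injective hι hθ h2) _ h
  rw [Prod.smul_mk, Prod.mk_eq_zero] at h1
  obtain ⟨m, hm⟩ := GW.two_primary_of_isOfFinAddOrder h2
    (isOfFinAddOrder_iff_nsmul_eq_zero.2 ⟨n, hn, h1.1⟩)
  have hφ : ∀ i, ∃ k : ℕ, (2 : Witt F) ^ k * φ i = 0 := fun i =>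
    Witt.two_primary_of_isOfFinAddOrder h2
      (isOfFinAddOrder_iff_nsmul_eq_zero.2 ⟨n, hn, by rw [← Finsupp.smul_apply, h1.2]; rfl⟩)
  choose k hk using hφ
  -- The support is finite, so one exponent serves all components at once.
  have hφ' : (2 ^ ∑ i ∈ φ.support, k i : ℕ) • φ = 0 := by
    ext i
    rw [Finsupp.smul_apply, nsmul_eq_mul, Finsupp.zero_apply]
    push_cast
    by_cases hi : i ∈ φ.support
    · rw [← Finset.add_sum_erase _ _ hi, pow_add, mul_right_comm, hk, zero_mul]
    · rw [Finsupp.notMem_support_iff.1 hi, mul_zero]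
  refine ⟨m + ∑ i ∈ φ.support, k i, ?_⟩
  rw [← map_nsmul, Prod.smul_mk, pow_add, mul_smul, mul_smul, hφ', smul_zero, smul_comm, hm,
    smul_zero]
  exact map_zero _

lemma theta_injective (hι : ∀ a, ι (GW.diag a) = angle a)
    (hθ : ∀ n, 1 ≤ n → ∀ x, θ n (Witt.proj F x) = ι x * eta F ^ n)
    (h2 : (2 : F) ≠ 0) {n : ℕ} (hn : 1 ≤ n) : Function.Injective (θ n) := by
  rw [injective_iff_map_eq_zero]
  intro φ h
  obtain ⟨m, rfl⟩ := Nat.exists_eq_add_of_le' hn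
  have := (injective_iff_map_eq_zero _).1 (nonposHom_injective hι hθ h2) (0, Finsupp.single m φ)
    (by simpa [nonposHom] using h)
  simpa using this

lemma theta_range (hι : ∀ a, ι (GW.diag a) = angle a)
    (hθ : ∀ n, 1 ≤ n → ∀ x, θ n (Witt.proj F x) = ι x * eta F ^ n)
    (h2 : (2 : F) ≠ 0) {n : ℕ} (hn : 1 ≤ n) :
    (θ n).range = homog F (-(n : ℤ)) := by
  ext x
  rw [mem_homog_neg_iff hι h2]
  constructor
  · rintro ⟨φ, rfl⟩
    obtain ⟨y, rfl⟩ := Ideal.Quotient.mk_surjective φ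
    exact ⟨y, hθ n hn y⟩
  · rintro ⟨y, rfl⟩
    exact ⟨Witt.proj F y, hθ n hn y⟩

lemma isNilpotent_theta_iff (hι : ∀ a, ι (GW.diag a) = angle a)
    (hθ : ∀ n, 1 ≤ n → ∀ x, θ n (Witt.proj F x) = ι x * eta F ^ n)
    (h2 : (2 : F) ≠ 0) {n : ℕ} (hn : 1 ≤ n) {φ : Witt F} :
    IsNilpotent (θ n φ) ↔ IsNilpotent φ := by
  constructor
  · rintro ⟨k, hk⟩
    -- Raising the exponent to k + 1 makes it positive, as `theta_pow` requires.
    refine ⟨k + 1, theta_injective hι hθ h2 (Nat.mul_pos hn k.succ_pos) ?_⟩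
    rw [← theta_pow hθ hn k.succ_pos, pow_succ, hk, zero_mul, map_zero]
  · rintro ⟨k, hk⟩
    refine ⟨k + 1, ?_⟩
    rw [theta_pow hθ hn k.succ_pos, pow_succ, hk, zero_mul, map_zero]

lemma iota_injective (hι : ∀ a, ι (GW.diag a) = angle a)
    (hθ : ∀ n, 1 ≤ n → ∀ x, θ n (Witt.proj F x) = ι x * eta F ^ n)
    (h2 : (2 : F) ≠ 0) : Function.Injective ι := by
  rw [injective_iff_map_eq_zero]
  intro y h
  have := (injective_iff_map_eq_zero _).1 (nonposHom_injective hι hθ h2) (y, 0)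
    (by simpa [nonposHom] using h)
  simpa using this

end

end KMW

end

/-! ### Assembly of the main theorem -/

theorem mainTheorem6 (F : Type u) [Field F] (hF : ringChar F ≠ 2) :
    ∃ (ι : GW F →+* KMW F) (θ : ℕ → Witt F →+ KMW F),
      -- the identification `GW(F) ≅ K^MW_0(F)`, determined by `⟨a⟩ ↦ 1 + η[a]`
      (∀ a : Fˣ, ι (GW.diag a) = 1 + KMW.eta F * KMW.symbol a) ∧
      Function.Injective ι ∧ ι.range.toAddSubgroup = KMW.homog F 0 ∧
      -- the identifications `W(F) ≅ K^MW_{-n}(F)`, `φ ↦ φ η^n`, for `n ≥ 1`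
      (∀ n : ℕ, 1 ≤ n →
        (∀ x : GW F, θ n (Witt.proj F x) = ι x * KMW.eta F ^ n) ∧
        Function.Injective (θ n) ∧ (θ n).range = KMW.homog F (-(n : ℤ))) ∧
      -- all torsion in non-positive degrees is 2-primary
      (∀ x ∈ KMW.nonpos F, IsOfFinAddOrder x → ∃ m : ℕ, (2 ^ m : ℕ) • x = 0) ∧
      -- degree zero: nilpotent = torsion
      (∀ x ∈ KMW.homog F 0, IsNilpotent x ↔ IsOfFinAddOrder x) ∧
      -- degree `-n < 0`: nilpotent = of the form `φ η^n` with `φ` torsion of even rank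
      (∀ n : ℕ, 1 ≤ n → ∀ x : KMW F,
        (x ∈ KMW.homog F (-(n : ℤ)) ∧ IsNilpotent x) ↔
          ∃ φ : Witt F, IsOfFinAddOrder φ ∧ Witt.rank F φ = 0 ∧ x = θ n φ) := by
  have h2 : (2 : F) ≠ 0 := Ring.two_ne_zero hF
  obtain ⟨ι, hι⟩ := KMW.exists_ringHom_of_GW h2
  choose θ' hθ' using fun n (hn : 1 ≤ n) => KMW.exists_addMonoidHom_of_Witt hι hn
  obtain ⟨θ, hθ⟩ : ∃ θ : ℕ → Witt F →+ KMW F,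
      ∀ n, 1 ≤ n → ∀ x, θ n (Witt.proj F x) = ι x * KMW.eta F ^ n :=
    ⟨fun n => if hn : 1 ≤ n then θ' n hn else 0, fun n hn x => by
      simp only [dif_pos hn]; exact hθ' n hn x⟩
  have hinj : Function.Injective ι := KMW.iota_injective hι hθ h2
  have hrange : ∀ x, x ∈ KMW.homog F 0 ↔ ∃ y, x = ι y := fun x => by
    simpa using KMW.mem_homog_neg_iff hι h2 0 (x := x)
  refine ⟨ι, θ, hι, hinj, ?_, fun n hn => ⟨hθ n hn, KMW.theta_injective hι hθ h2 hn,
    KMW.theta_range hι hθ h2 hn⟩, fun x => KMW.two_primary_of_mem_nonpos hι hθ h2, ?_, ?_⟩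
  · ext x
    rw [hrange]
    exact ⟨fun ⟨y, h⟩ => ⟨y, h.symm⟩, fun ⟨y, h⟩ => ⟨y, h.symm⟩⟩
  · intro x hx
    obtain ⟨y, rfl⟩ := (hrange x).1 hx
    rw [IsNilpotent.map_iff hinj, GW.isNilpotent_iff_isOfFinAddOrder h2]
    exact (Function.Injective.isOfFinAddOrder_iff (f := ι.toAddMonoidHom) hinj).symm
  · intro n hn x
    rw [← KMW.theta_range hι hθ h2 hn]
    constructor
    · rintro ⟨⟨φ, rfl⟩, h⟩
      obtain ⟨ht, hr⟩ := (Witt.isNilpotent_iff h2).1 ((KMW.isNilpotent_theta_iff hι hθ h2 hn).1 h)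
      exact ⟨φ, ht, hr, rfl⟩
    · rintro ⟨φ, ht, hr, rfl⟩
      exact ⟨⟨φ, rfl⟩, (KMW.isNilpotent_theta_iff hι hθ h2 hn).2
        ((Witt.isNilpotent_iff h2).2 ⟨ht, hr⟩)⟩
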